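/- Two divisible items, one unit each, are to be allocated between two agents. A bid (or utility) vector over the two items is normalized if it has the form $(t,1-t)$ with $t\in[0,1]$, and the utilities are linear. A mechanism maps each pair of normalized bid vectors to amounts $A_{ij}$ of item $j$ given to agent $i$. It is feasible if $A_{ij}\ge 0$ and $A_{1j}+A_{2j}\le 1$ for all $i,j$ and all bids (so items may be allocated only partially). It is strategyproof if, for every bid of the other agent, bidding her true utility vector maximizes an agent's utility. It is $\alpha$-competitive if for all utility vectors $\vec u_1,\vec u_2$ its social welfare under truthful bids is at least $\alpha\sum_j\max\{u_{1j},u_{2j}\}$. It is symmetric if renaming the agents or the items in the bids renames the allocation in the same way. A function $A$ on $[0,1]^2$ describes the mechanism $A_{11}=A(b_1,b_2)$, $A_{12}=A(1-b_1,1-b_2)$, $A_{21}=A(b_2,b_1)$, $A_{22}=A(1-b_2,1-b_1)$, where $b_i$ is the first entry of agent $i$'s bid vector. Let $f_1(t)=t$ and $f_2(t)=\ln(2t)-t+\tfrac12$, let $N=1000$, $\delta=2.92/2000$ and $[N]=\{0,\tfrac1N,\dots,1\}$. For $Q,R:[N]\to\mathbb R$, $t_1\in[0,1]$ and $t_2\in[N]$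 put $$A_{Q,R}(t_1,t_2)=\begin{cases}Q(t_2)f_1(t_1)+R(t_2), & t_1\in[0,\tfrac12],\\ A_{Q,R}(\tfrac12,t_2)+Q(1-t_2)f_2(t_1), & t_1\in(\tfrac12,1],\end{cases}$$ and $\hat u_{Q,R}(t_1,t_2)=t_1A_{Q,R}(t_1,t_2)+(1-t_1)A_{Q,R}(1-t_1,1-t_2)$. Consider the linear program in the variables $Q(t),R(t)$ $(t\in[N])$ and $\lambda$: maximize $\lambda$ subject to, for all $t_1,t_2,t\in[N]$, $$A_{Q,R}(t_1,t_2)+A_{Q,R}(t_2,t_1)\le 1-\delta,\qquad \hat u_{Q,R}(t_1,t_2)+\hat u_{Q,R}(t_2,t_1)\ge(1+|t_1-t_2|)\lambda,\qquad Q(t),R(t)\ge 0.$$ Then the linear program has an optimal solution $(Q^*,R^*,\lambda^*)$ with $\lambda^*>0.835524$ and $Q^*(t)<1.46$ for all $t\in[N]$. For every optimal solution $(Q^*,R^*,\lambda^*)$ with $Q^*(t)<1.46$ for all $t\in[N]$, and for every rounding $t\mapsto\tilde t$ of $[0,1]$ to a nearest point of $[N]$ whose ties are broken so that $\widetilde{1-t}=1-\tilde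 t$ (such roundings exist), the mechanism described by $\tilde A(t_1,t_2)=A_{Q^*,R^*}(t_1,\tilde t_2)$ is symmetric, feasible, strategyproof and $0.833689$-competitive. Moreover, $0.833689>\tfrac56+10^{-9}$, so partial mechanisms strictly beat $\tfrac56$. -/

import Mathlib

/-!
Strategyproof allocation, without money, of `m` divisible items between two agents with
normalized linear utilities.
-/

namespace PartialMechanism

open Finset

noncomputable section

/-- A bid profile assigns to each of the two agents a bid vector over the `m` items. -/
abbrev Profile (m : ℕ) : Type := Fin 2 → Fin m → ℝ

/-- A mechanism maps a bid profile `b` to an allocation: `M b i j` is the amount of item `j`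
that agent `i` receives. Its values matter only on normalized profiles. -/
abbrev Mechanism (m : ℕ) : Type := Profile m → Fin 2 → Fin m → ℝ

/-- Every bid vector is normalized: its entries are nonnegative and sum to one. -/
def IsNormalized {m : ℕ} (b : Profile m) : Prop :=
  ∀ i, b i ∈ stdSimplex ℝ (Fin m)

/-- Amounts are nonnegative, and at most one unit of each item is handed out
(part of an item may be withheld). -/
def IsFeasible {m : ℕ} (M : Mechanism m) : Prop :=
  ∀ b, IsNormalized b → (∀ i j, 0 ≤ M b i j) ∧ ∀ j, M b 0 j + M b 1 j ≤ 1

/-- The utility of agent `i`, whose true utility vector is `u`, under the bids `b`. -/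
def utility {m : ℕ} (M : Mechanism m) (u : Fin m → ℝ) (b : Profile m) (i : Fin 2) : ℝ :=
  ∑ j, u j * M b i j

/-- Whatever the other agent bids, bidding the true utility vector is at least as good as
any other bid. -/
def IsStrategyproof {m : ℕ} (M : Mechanism m) : Prop :=
  ∀ (i : Fin 2) (u : Fin m → ℝ) (b : Profile m), u ∈ stdSimplex ℝ (Fin m) → IsNormalized b →
    utility M u b i ≤ utility M u (Function.update b i u) i

/-- The social welfare when both agents bid their true utility vectors. -/
def socialWelfare {m : ℕ} (M : Mechanism m) (u : Profile m) : ℝ :=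
  ∑ i, utility M (u i) u i

/-- The first-best social welfare. -/
def optWelfare {m : ℕ} (u : Profile m) : ℝ :=
  ∑ j, max (u 0 j) (u 1 j)

/-- The welfare guarantee of an `α`-competitive mechanism. -/
def IsCompetitive {m : ℕ} (α : ℝ) (M : Mechanism m) : Prop :=
  ∀ u, IsNormalized u → α * optWelfare u ≤ socialWelfare M u

/-- Symmetry over agents and over items: renaming the agents by `σ` and the items by `τ` in the
bids renames the allocation in the same way. -/
def IsSymmetric {m : ℕ} (M : Mechanism m) : Prop :=
  ∀ (σ : Equiv.Perm (Fin 2)) (τ : Equiv.Perm (Fin m)) (b : Profile m), IsNormalized b →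
    ∀ i j, M (fun i' j' => b (σ i') (τ j')) i j = M b (σ i) (τ j)

/-- The two-item mechanism described by a single function `A` on `[0,1]²`. A normalized bid
vector `(t, 1 - t)` is represented by its first entry `t`. -/
def ofFun (A : ℝ → ℝ → ℝ) : Mechanism 2 := fun b =>
  ![![A (b 0 0) (b 1 0), A (1 - b 0 0) (1 - b 1 0)],
    ![A (b 1 0) (b 0 0), A (1 - b 1 0) (1 - b 0 0)]]

/-- `f₁(t) = t`, used on `[0,1/2]`. -/
def f₁ (t : ℝ) : ℝ := t

/-- `f₂(t) = ln(2t) - t + 1/2`, used on `[1/2,1]`. -/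
def f₂ (t : ℝ) : ℝ := Real.log (2 * t) - t + 1 / 2

/-- The grid point `k/N`; note that `gridPt k.rev = 1 - gridPt k` for `N > 0`. -/
def gridPt {N : ℕ} (k : Fin (N + 1)) : ℝ := (k : ℝ) / (N : ℝ)

/-- The allocation function with coefficient vectors `Q`, `R` indexed by the grid, with a real
first argument `t` and a grid point `k/N` as second argument. -/
def alloc {N : ℕ} (Q R : Fin (N + 1) → ℝ) (t : ℝ) (k : Fin (N + 1)) : ℝ :=
  if t ≤ 1 / 2 then Q k * f₁ t + R k
  else (Q k * f₁ (1 / 2) + R k) + Q k.rev * f₂ t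

/-- The utility of a truthful agent with utility vector `(k/N, 1 - k/N)` against the bid `l/N`. -/
def gridUtility {N : ℕ} (Q R : Fin (N + 1) → ℝ) (k l : Fin (N + 1)) : ℝ :=
  gridPt k * alloc Q R (gridPt k) l + (1 - gridPt k) * alloc Q R (gridPt k.rev) l.rev

/-- The constraints of the linear program in the variables `Q`, `R`, `lam`. -/
structure LPFeasible (N : ℕ) (δ : ℝ) (Q R : Fin (N + 1) → ℝ) (lam : ℝ) : Prop where
  feasible : ∀ k l, alloc Q R (gridPt k) l + alloc Q R (gridPt l) k ≤ 1 - δ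
  competitive : ∀ k l,
    (1 + |gridPt k - gridPt l|) * lam ≤ gridUtility Q R k l + gridUtility Q R l k
  nonneg : ∀ k, 0 ≤ Q k ∧ 0 ≤ R k

/-- `(Q, R, lam)` is an optimal solution of the linear program: it maximizes `lam`. -/
def LPOptimal (N : ℕ) (δ : ℝ) (Q R : Fin (N + 1) → ℝ) (lam : ℝ) : Prop :=
  LPFeasible N δ Q R lam ∧ ∀ Q' R' lam', LPFeasible N δ Q' R' lam' → lam' ≤ lam

/-- `ρ` rounds each `t ∈ [0,1]` to a nearest grid point `ρ(t)/N`, and ties are broken so that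
the rounding respects the exchange `t ↦ 1 - t` of the two items. -/
structure IsRounding (N : ℕ) (ρ : ℝ → Fin (N + 1)) : Prop where
  nearest : ∀ t ∈ Set.Icc (0 : ℝ) 1, ∀ k : Fin (N + 1), |t - gridPt (ρ t)| ≤ |t - gridPt k|
  symm : ∀ t ∈ Set.Icc (0 : ℝ) 1, ρ (1 - t) = (ρ t).rev

/-- The mechanism with coefficients `Q`, `R`, in which the bid of the other agent is rounded
to the grid. -/
def roundedMechanism {N : ℕ} (Q R : Fin (N + 1) → ℝ) (ρ : ℝ → Fin (N + 1)) : Mechanism 2 :=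
  ofFun fun t₁ t₂ => alloc Q R t₁ (ρ t₂)

end

end PartialMechanism

/-!
Against a fixed bid `l` of the other agent, `A(t, l)` and `A(1 - t, 1 - l)` are combinations of
`f₁` and `f₂` with the same coefficients, and `t f₂'(t) = (1 - t) f₁'(1 - t)` makes the truthful
bid optimal. Rounding the bid of the other agent costs at most `Q / N` in the feasibility
constraints, which `δ` absorbs, and of order `1 / N` in the welfare constraints.

The optimum of the linear program exists by compactness and is compared with an explicit rational
table. At the table all but 14 constraints (up to the symmetries) have slack exceeding `10⁻⁹`. The
14 remaining ones and four constraints `0 ≤ R k`, weighted by a rounded dual solution, add up to an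
upper bound for the objective. Hence a solution at least as good as the table makes them all nearly
tight, and solving the nearly tight system shows that the quantities that enter it are
`10⁻⁹`-close to those of the table. Replacing all other coordinates of an optimal solution by those
of the table therefore keeps it feasible and optimal, and brings `Q` below `1.46`.
-/

namespace PartialMechanism

open Finset

/-! ### The allocation function -/

lemma f₂_half : f₂ (1 / 2) = 0 := by
  simp [f₂]

lemma f₂_le_tangent {s t : ℝ} (hs : 0 < s) (ht : 0 < t) :
    f₂ s ≤ f₂ t + (1 / t - 1) * (s - t) := by
  have log_le := Real.log_le_sub_one_of_pos (div_pos hs ht)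
  rw [Real.log_div hs.ne' ht.ne'] at log_le
  have slope : (1 / t - 1) * (s - t) = s / t - 1 - (s - t) := by field_simp
  rw [slope, f₂, f₂, Real.log_mul two_ne_zero ht.ne', Real.log_mul two_ne_zero hs.ne']
  linarith

lemma monotoneOn_f₂ : MonotoneOn f₂ (Set.Ioc 0 1) := by
  intro s hs t ht hst
  have tangent := f₂_le_tangent hs.1 ht.1
  have slope_nonneg : 0 ≤ 1 / t - 1 := sub_nonneg.2 ((one_le_div ht.1).2 ht.2)
  nlinarith

/-- The function `f₁`, extended to `t ≥ 1/2` by its value at `1/2`: the coefficient of `Q(t₂)` in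
`A(t, t₂)`. -/
noncomputable def lowBasis (t : ℝ) : ℝ := min t (1 / 2)

/-- The function `f₂`, extended to `t ≤ 1/2` by its value `0` at `1/2`: the coefficient of
`Q(1 - t₂)` in `A(t, t₂)`. -/
noncomputable def highBasis (t : ℝ) : ℝ := f₂ (max t (1 / 2))

lemma lowBasis_of_le {t : ℝ} (ht : t ≤ 1 / 2) : lowBasis t = t := min_eq_left ht

lemma lowBasis_of_ge {t : ℝ} (ht : 1 / 2 ≤ t) : lowBasis t = 1 / 2 := min_eq_right ht

lemma highBasis_of_le {t : ℝ} (ht : t ≤ 1 / 2) : highBasis t = 0 := by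
  rw [highBasis, max_eq_right ht, f₂_half]

lemma highBasis_of_ge {t : ℝ} (ht : 1 / 2 ≤ t) : highBasis t = f₂ t := by
  rw [highBasis, max_eq_left ht]

lemma lowBasis_mono : Monotone lowBasis := fun _ _ hst => min_le_min_right _ hst

lemma highBasis_le {s t : ℝ} (hst : s ≤ t) (ht : t ≤ 1) : highBasis s ≤ highBasis t :=
  monotoneOn_f₂ ⟨by positivity, max_le (hst.trans ht) (by norm_num)⟩
    ⟨by positivity, max_le ht (by norm_num)⟩ (max_le_max_right _ hst)

lemma lowBasis_add_highBasis_sub_le {s t : ℝ} (hst : s ≤ t) :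
    lowBasis t + highBasis t - (lowBasis s + highBasis s) ≤ t - s := by
  have half_le : 1 / 2 ≤ max s (1 / 2) := le_max_right _ _
  have max_le : max s (1 / 2) ≤ max t (1 / 2) := max_le_max_right _ hst
  have tangent := f₂_le_tangent (s := max t (1 / 2)) (t := max s (1 / 2)) (by positivity)
    (by positivity)
  have slope_le_one : 1 / max s (1 / 2) - 1 ≤ 1 := by
    rw [sub_le_iff_le_add, div_le_iff₀ (by positivity)]; linarith
  have split (x : ℝ) : min x (1 / 2) + max x (1 / 2) = x + 1 / 2 := min_add_max x (1 / 2)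
  simp only [lowBasis, highBasis]
  nlinarith [split s, split t]

section Basis

variable {t : ℝ} (h0 : 0 ≤ t)

include h0

lemma lowBasis_nonneg : 0 ≤ lowBasis t := le_min h0 (by norm_num)

lemma highBasis_nonneg (h1 : t ≤ 1) : 0 ≤ highBasis t := by
  simpa only [highBasis_of_le (show (0 : ℝ) ≤ 1 / 2 by norm_num)] using highBasis_le h0 h1

lemma lowBasis_add_highBasis_le : lowBasis t + highBasis t ≤ t := by
  have := lowBasis_add_highBasis_sub_le h0
  rw [lowBasis_of_le (t := 0) (by norm_num), highBasis_of_le (t := 0) (by norm_num)] at this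
  linarith

end Basis

lemma truthful_basis {t : ℝ} (h1 : t ≤ 1) (s : ℝ) :
    t * lowBasis s + (1 - t) * highBasis (1 - s) ≤
      t * lowBasis t + (1 - t) * highBasis (1 - t) := by
  have max_one_sub (x : ℝ) : max (1 - x) (1 / 2) = 1 - lowBasis x := by
    rw [lowBasis, ← max_sub_sub_left, show (1 : ℝ) - 1 / 2 = 1 / 2 by norm_num]
  have low_le (x : ℝ) : lowBasis x ≤ 1 / 2 := min_le_right _ _
  simp only [highBasis, max_one_sub]
  have tangent := f₂_le_tangent (s := 1 - lowBasis s) (t := 1 - lowBasis t)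
    (by linarith [low_le s]) (by linarith [low_le t])
  suffices (1 - t) * ((1 / (1 - lowBasis t) - 1) * (lowBasis t - lowBasis s)) ≤
      t * (lowBasis t - lowBasis s) by nlinarith
  rcases le_total t (1 / 2) with ht | ht
  · rw [lowBasis_of_le ht]
    have : 1 - t ≠ 0 := by linarith
    exact le_of_eq (by field_simp; ring)
  · rw [lowBasis_of_ge ht]
    nlinarith [low_le s]

section Alloc

variable {N : ℕ} {Q R : Fin (N + 1) → ℝ}

lemma alloc_eq (Q R : Fin (N + 1) → ℝ) (t : ℝ) (k : Fin (N + 1)) :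
    alloc Q R t k = Q k * lowBasis t + R k + Q k.rev * highBasis t := by
  rcases le_or_gt t (1 / 2) with ht | ht
  · simp only [alloc, f₁, if_pos ht, lowBasis_of_le ht, highBasis_of_le ht, mul_zero, add_zero]
  · simp only [alloc, f₁, if_neg ht.not_ge, lowBasis_of_ge ht.le, highBasis_of_ge ht.le]

lemma alloc_mono (hQ : ∀ k, 0 ≤ Q k) {s t : ℝ} (hst : s ≤ t) (ht : t ≤ 1) (k : Fin (N + 1)) :
    alloc Q R s k ≤ alloc Q R t k := by
  rw [alloc_eq, alloc_eq]
  gcongr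
  · exact hQ k
  · exact lowBasis_mono hst
  · exact hQ k.rev
  · exact highBasis_le hst ht

lemma alloc_nonneg (hQ : ∀ k, 0 ≤ Q k) (hR : ∀ k, 0 ≤ R k) {t : ℝ} (h0 : 0 ≤ t) (h1 : t ≤ 1)
    (k : Fin (N + 1)) : 0 ≤ alloc Q R t k := by
  rw [alloc_eq]
  have := mul_nonneg (hQ k) (lowBasis_nonneg h0)
  have := mul_nonneg (hQ k.rev) (highBasis_nonneg h0 h1)
  linarith [hR k]

lemma abs_alloc_sub_le {M : ℝ} (hQ : ∀ k, 0 ≤ Q k) (hM : ∀ k, Q k ≤ M) {s t : ℝ}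
    (hs : s ≤ 1) (ht : t ≤ 1) (k : Fin (N + 1)) :
    |alloc Q R t k - alloc Q R s k| ≤ M * |t - s| := by
  wlog hst : s ≤ t generalizing s t
  · rw [abs_sub_comm, abs_sub_comm t]
    exact this ht hs (le_of_not_ge hst)
  rw [abs_of_nonneg (sub_nonneg.2 (alloc_mono hQ hst ht k)), abs_of_nonneg (sub_nonneg.2 hst)]
  have slope := lowBasis_add_highBasis_sub_le hst
  calc alloc Q R t k - alloc Q R s k
      = Q k * (lowBasis t - lowBasis s) + Q k.rev * (highBasis t - highBasis s) := by
        rw [alloc_eq, alloc_eq]; ring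
    _ ≤ M * (lowBasis t - lowBasis s) + M * (highBasis t - highBasis s) := by
        gcongr
        · exact sub_nonneg.2 (lowBasis_mono hst)
        · exact hM k
        · exact sub_nonneg.2 (highBasis_le hst ht)
        · exact hM k.rev
    _ ≤ M * (t - s) := by
        rw [← mul_add]
        exact mul_le_mul_of_nonneg_left (by linarith) ((hQ k).trans (hM k))

lemma alloc_truthful (hQ : ∀ k, 0 ≤ Q k) {t : ℝ} (h0 : 0 ≤ t) (h1 : t ≤ 1) (s : ℝ)
    (l : Fin (N + 1)) :
    t * alloc Q R s l + (1 - t) * alloc Q R (1 - s) l.rev ≤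
      t * alloc Q R t l + (1 - t) * alloc Q R (1 - t) l.rev := by
  have first := mul_le_mul_of_nonneg_left (truthful_basis h1 s) (hQ l)
  have second := mul_le_mul_of_nonneg_left (truthful_basis (sub_le_self 1 h0) (1 - s)) (hQ l.rev)
  simp only [sub_sub_cancel] at second
  simp only [alloc_eq, Fin.rev_rev]
  linarith

lemma abs_alloc_sub_alloc_le {Q' R' : Fin (N + 1) → ℝ} {ε : ℝ} (hQ : ∀ k, |Q k - Q' k| ≤ ε)
    (hR : ∀ k, |R k - R' k| ≤ ε) {t : ℝ} (h0 : 0 ≤ t) (h1 : t ≤ 1) (k : Fin (N + 1)) :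
    |alloc Q R t k - alloc Q' R' t k| ≤ 2 * ε := by
  have low := lowBasis_nonneg h0
  have high := highBasis_nonneg h0 h1
  have sum_le := lowBasis_add_highBasis_le h0
  have hε : 0 ≤ ε := (abs_nonneg _).trans (hR k)
  calc |alloc Q R t k - alloc Q' R' t k|
      = |(Q k - Q' k) * lowBasis t + (R k - R' k) + (Q k.rev - Q' k.rev) * highBasis t| := by
        rw [alloc_eq, alloc_eq]; ring_nf
    _ ≤ |Q k - Q' k| * lowBasis t + |R k - R' k| + |Q k.rev - Q' k.rev| * highBasis t := by
        refine (abs_add_three _ _ _).trans_eq ?_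
        rw [abs_mul, abs_mul, abs_of_nonneg low, abs_of_nonneg high]
    _ ≤ ε * lowBasis t + ε + ε * highBasis t := by
        gcongr
        exacts [hQ k, hR k, hQ k.rev]
    _ ≤ 2 * ε := by nlinarith

end Alloc

/-! ### Mechanisms described by a function on the unit square -/

lemma stdSimplex_fin_two {u : Fin 2 → ℝ} (hu : u ∈ stdSimplex ℝ (Fin 2)) :
    u 0 ∈ Set.Icc (0 : ℝ) 1 ∧ u 1 = 1 - u 0 := by
  obtain ⟨nonneg, sum_eq⟩ := hu
  rw [Fin.sum_univ_two] at sum_eq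
  exact ⟨⟨nonneg 0, by linarith [nonneg 1]⟩, by linarith⟩

lemma one_sub_mem_unitInterval {t : ℝ} (ht : t ∈ Set.Icc (0 : ℝ) 1) :
    1 - t ∈ Set.Icc (0 : ℝ) 1 :=
  ⟨sub_nonneg.2 ht.2, sub_le_self 1 ht.1⟩

lemma optWelfare_fin_two {u : Profile 2} (hu : IsNormalized u) :
    optWelfare u = 1 + |u 0 0 - u 1 0| := by
  rw [optWelfare, Fin.sum_univ_two, (stdSimplex_fin_two (hu 0)).2, (stdSimplex_fin_two (hu 1)).2]
  rcases le_total (u 0 0) (u 1 0) with h | h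
  · rw [max_eq_right h, max_eq_left (by linarith), abs_of_nonpos (by linarith)]; ring
  · rw [max_eq_left h, max_eq_right (by linarith), abs_of_nonneg (by linarith)]; ring

lemma utility_ofFun (A : ℝ → ℝ → ℝ) (u : Fin 2 → ℝ) (b : Profile 2) (i : Fin 2) :
    utility (ofFun A) u b i =
      u 0 * A (b i 0) (b i.rev 0) + u 1 * A (1 - b i 0) (1 - b i.rev 0) := by
  fin_cases i <;> simp [utility, ofFun, Fin.sum_univ_two]

lemma isSymmetric_ofFun (A : ℝ → ℝ → ℝ) : IsSymmetric (ofFun A) := by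
  intro σ τ b hb i j
  have second₀ := (stdSimplex_fin_two (hb 0)).2
  have second₁ := (stdSimplex_fin_two (hb 1)).2
  have hσ : σ = 1 ∨ σ = Equiv.swap 0 1 := by revert σ; decide
  have hτ : τ = 1 ∨ τ = Equiv.swap 0 1 := by revert τ; decide
  rcases hσ with rfl | rfl <;> rcases hτ with rfl | rfl <;> fin_cases i <;> fin_cases j <;>
    simp [ofFun, second₀, second₁]

lemma isFeasible_ofFun {A : ℝ → ℝ → ℝ}
    (nonneg : ∀ s ∈ Set.Icc (0 : ℝ) 1, ∀ t ∈ Set.Icc (0 : ℝ) 1, 0 ≤ A s t)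
    (add_le : ∀ s ∈ Set.Icc (0 : ℝ) 1, ∀ t ∈ Set.Icc (0 : ℝ) 1, A s t + A t s ≤ 1) :
    IsFeasible (ofFun A) := by
  intro b hb
  have mem (i : Fin 2) : b i 0 ∈ Set.Icc (0 : ℝ) 1 := (stdSimplex_fin_two (hb i)).1
  have mem' (i : Fin 2) := one_sub_mem_unitInterval (mem i)
  refine ⟨fun i j => ?_, fun j => ?_⟩
  · fin_cases i <;> fin_cases j
    exacts [nonneg _ (mem 0) _ (mem 1), nonneg _ (mem' 0) _ (mem' 1), nonneg _ (mem 1) _ (mem 0),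
      nonneg _ (mem' 1) _ (mem' 0)]
  · fin_cases j
    exacts [add_le _ (mem 0) _ (mem 1), add_le _ (mem' 0) _ (mem' 1)]

lemma isStrategyproof_ofFun {A : ℝ → ℝ → ℝ}
    (truthful : ∀ t ∈ Set.Icc (0 : ℝ) 1, ∀ t₂ ∈ Set.Icc (0 : ℝ) 1, ∀ s,
      t * A s t₂ + (1 - t) * A (1 - s) (1 - t₂) ≤ t * A t t₂ + (1 - t) * A (1 - t) (1 - t₂)) :
    IsStrategyproof (ofFun A) := by
  intro i u b hu hb
  have hi : i.rev ≠ i := by fin_cases i <;> decide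
  rw [utility_ofFun, utility_ofFun, Function.update_self, Function.update_of_ne hi,
    (stdSimplex_fin_two hu).2]
  exact truthful _ (stdSimplex_fin_two hu).1 _ (stdSimplex_fin_two (hb i.rev)).1 _

lemma isCompetitive_ofFun {A : ℝ → ℝ → ℝ} {α : ℝ}
    (welfare : ∀ s ∈ Set.Icc (0 : ℝ) 1, ∀ t ∈ Set.Icc (0 : ℝ) 1,
      α * (1 + |s - t|) ≤ (s * A s t + (1 - s) * A (1 - s) (1 - t)) +
        (t * A t s + (1 - t) * A (1 - t) (1 - s))) :
    IsCompetitive α (ofFun A) := by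
  intro u hu
  rw [optWelfare_fin_two hu, socialWelfare, Fin.sum_univ_two, utility_ofFun, utility_ofFun,
    (stdSimplex_fin_two (hu 0)).2, (stdSimplex_fin_two (hu 1)).2]
  exact welfare _ (stdSimplex_fin_two (hu 0)).1 _ (stdSimplex_fin_two (hu 1)).1

/-! ### Rounding to the grid -/

section Rounding

variable {N : ℕ}

lemma gridPt_mem (k : Fin (N + 1)) : gridPt k ∈ Set.Icc (0 : ℝ) 1 := by
  have hk : (k : ℝ) ≤ N := by exact_mod_cast k.is_le
  exact ⟨by unfold gridPt; positivity, div_le_one_of_le₀ hk (by positivity)⟩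

lemma gridPt_zero : gridPt (0 : Fin (N + 1)) = 0 := by simp [gridPt]

lemma gridPt_last (hN : 0 < N) : gridPt (Fin.last N) = 1 := by simp [gridPt, hN.ne']

lemma gridPt_rev (hN : 0 < N) (k : Fin (N + 1)) : gridPt k.rev = 1 - gridPt k := by
  have : (N : ℝ) ≠ 0 := by positivity
  rw [gridPt, gridPt, Fin.val_rev, Nat.add_sub_add_right, Nat.cast_sub k.is_le]
  field_simp

lemma gridPt_injective (hN : 0 < N) : Function.Injective (gridPt : Fin (N + 1) → ℝ) := by
  intro k l h
  have : (N : ℝ) ≠ 0 := by positivity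
  exact Fin.ext (by exact_mod_cast (div_left_inj' this).1 h)

lemma exists_abs_sub_gridPt_le (hN : 0 < N) {t : ℝ} (ht : t ∈ Set.Icc (0 : ℝ) 1) :
    ∃ k : Fin (N + 1), |t - gridPt k| ≤ 1 / (2 * N) := by
  have N_pos : (0 : ℝ) < N := by exact_mod_cast hN
  obtain ⟨lower, upper⟩ := abs_le.1 (abs_sub_round (N * t))
  have nonneg : -1 < round (N * t) := by
    have : (-1 : ℝ) < round (N * t) := by linarith [mul_nonneg N_pos.le ht.1]
    exact_mod_cast this
  have lt : round (N * t) < N + 1 := by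
    have : (round (N * t) : ℝ) < N + 1 := by nlinarith [ht.2]
    exact_mod_cast this
  obtain ⟨k, hk⟩ := Int.eq_ofNat_of_zero_le (show 0 ≤ round (N * t) by omega)
  refine ⟨⟨k, by omega⟩, ?_⟩
  have scaled : t - gridPt (N := N) ⟨k, by omega⟩ = (N * t - round (N * t)) / N := by
    rw [gridPt, hk, Int.cast_natCast]; field_simp
  rw [scaled, abs_div, abs_of_pos N_pos, div_le_div_iff₀ N_pos (by positivity)]
  nlinarith [abs_sub_round (N * t)]

lemma exists_isRounding {n : ℕ} (hn : 0 < n) :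
    ∃ ρ : ℝ → Fin (2 * n + 1), IsRounding (2 * n) ρ := by
  have N_pos : 0 < 2 * n := by omega
  choose r hr using fun t : ℝ => Finite.exists_min fun k : Fin (2 * n + 1) => |t - gridPt k|
  have r_half : gridPt (r (1 / 2)) = 1 / 2 := by
    have mid : gridPt (N := 2 * n) ⟨n, by omega⟩ = 1 / 2 := by
      have : (n : ℝ) ≠ 0 := by positivity
      rw [gridPt]; push_cast; field_simp
    have := hr (1 / 2) ⟨n, by omega⟩
    rw [mid, sub_self, abs_zero, abs_nonpos_iff] at this
    linarith
  have r_half_rev : (r (1 / 2)).rev = r (1 / 2) := by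
    apply gridPt_injective N_pos
    rw [gridPt_rev N_pos, r_half]; norm_num
  refine ⟨fun t => if t ≤ 1 / 2 then r t else (r (1 - t)).rev, fun t _ k => ?_, fun t _ => ?_⟩
  · split_ifs
    · exact hr t k
    · have := hr (1 - t) k.rev
      rw [gridPt_rev N_pos] at this ⊢
      rwa [← abs_neg, ← abs_neg (t - gridPt k), neg_sub, neg_sub, sub_right_comm,
        show gridPt k - t = 1 - t - (1 - gridPt k) by ring]
  · rcases lt_trichotomy t (1 / 2) with h | rfl | h
    · simp only [if_pos h.le, if_neg (show ¬1 - t ≤ 1 / 2 by linarith), sub_sub_cancel]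
    · simp only [show (1 : ℝ) - 1 / 2 = 1 / 2 by norm_num, le_rfl, if_true, r_half_rev]
    · simp only [if_neg h.not_ge, if_pos (show 1 - t ≤ 1 / 2 by linarith), Fin.rev_rev]

variable {ρ : ℝ → Fin (N + 1)}

lemma IsRounding.abs_sub_le (hρ : IsRounding N ρ) (hN : 0 < N) {t : ℝ}
    (ht : t ∈ Set.Icc (0 : ℝ) 1) : |t - gridPt (ρ t)| ≤ 1 / (2 * N) := by
  obtain ⟨k, hk⟩ := exists_abs_sub_gridPt_le hN ht
  exact (hρ.nearest t ht k).trans hk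

lemma IsRounding.abs_sub_le_add (hρ : IsRounding N ρ) (hN : 0 < N) {s t : ℝ}
    (hs : s ∈ Set.Icc (0 : ℝ) 1) (ht : t ∈ Set.Icc (0 : ℝ) 1) :
    |s - t| ≤ |gridPt (ρ s) - gridPt (ρ t)| + 1 / N := by
  have near_s := hρ.abs_sub_le hN hs
  have near_t := hρ.abs_sub_le hN ht
  have halves : 1 / (2 * (N : ℝ)) + 1 / (2 * N) = 1 / N := by field_simp; norm_num
  have := _root_.abs_sub_le s (gridPt (ρ s)) t
  have := _root_.abs_sub_le (gridPt (ρ s)) (gridPt (ρ t)) t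
  rw [abs_sub_comm (gridPt (ρ t)) t] at this
  linarith

end Rounding

/-! ### The rounded mechanism -/

section RoundedMechanism

variable {N : ℕ} {Q R : Fin (N + 1) → ℝ} {δ lam : ℝ} {ρ : ℝ → Fin (N + 1)}

lemma isStrategyproof_roundedMechanism (hQ : ∀ k, 0 ≤ Q k) (hρ : IsRounding N ρ) :
    IsStrategyproof (roundedMechanism Q R ρ) := by
  refine isStrategyproof_ofFun fun t ht t₂ ht₂ s => ?_
  rw [hρ.symm t₂ ht₂]
  exact alloc_truthful hQ ht.1 ht.2 s _

lemma LPFeasible.alloc_nonneg (h : LPFeasible N δ Q R lam) {t : ℝ} (ht : t ∈ Set.Icc (0 : ℝ) 1)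
    (k : Fin (N + 1)) : 0 ≤ alloc Q R t k :=
  PartialMechanism.alloc_nonneg (fun k => (h.nonneg k).1) (fun k => (h.nonneg k).2) ht.1 ht.2 k

lemma LPFeasible.alloc_le (h : LPFeasible N δ Q R lam) (hN : 0 < N) {t : ℝ} (ht : t ≤ 1)
    (k : Fin (N + 1)) : alloc Q R t k ≤ 1 - δ := by
  have mono := alloc_mono (R := R) (fun k => (h.nonneg k).1) ht le_rfl k
  have nonneg := h.alloc_nonneg (gridPt_mem k) (Fin.last N)
  have feasible := h.feasible (Fin.last N) k
  rw [gridPt_last hN] at feasible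
  linarith

lemma isFeasible_roundedMechanism (hN : 0 < N) {M : ℝ} (h : LPFeasible N δ Q R lam)
    (hM : ∀ k, Q k ≤ M) (hδ : M / N ≤ δ) (hρ : IsRounding N ρ) :
    IsFeasible (roundedMechanism Q R ρ) := by
  have hQ := fun k => (h.nonneg k).1
  have M_nonneg : 0 ≤ M := (hQ 0).trans (hM 0)
  have le_rounded {s : ℝ} (hs : s ∈ Set.Icc (0 : ℝ) 1) (k : Fin (N + 1)) :
      alloc Q R s k ≤ alloc Q R (gridPt (ρ s)) k + M * (1 / (2 * N)) := by
    have change := abs_alloc_sub_le (R := R) hQ hM (gridPt_mem (ρ s)).2 hs.2 k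
    have := mul_le_mul_of_nonneg_left (hρ.abs_sub_le hN hs) M_nonneg
    linarith [le_abs_self (alloc Q R s k - alloc Q R (gridPt (ρ s)) k)]
  refine isFeasible_ofFun (fun s hs t _ => h.alloc_nonneg hs _) fun s hs t ht => ?_
  have halves : M * (1 / (2 * N)) + M * (1 / (2 * N)) = M / N := by field_simp; ring
  linarith [le_rounded hs (ρ t), le_rounded ht (ρ s), h.feasible (ρ s) (ρ t)]

lemma LPFeasible.gridUtility_sub_le (h : LPFeasible N δ Q R lam) (hN : 0 < N)
    (hρ : IsRounding N ρ) {t : ℝ} (ht : t ∈ Set.Icc (0 : ℝ) 1) (l : Fin (N + 1)) :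
    gridUtility Q R (ρ t) l - (1 - δ) * (1 / (2 * N)) ≤
      t * alloc Q R t l + (1 - t) * alloc Q R (1 - t) l.rev := by
  set s := gridPt (ρ t)
  have hs : s ∈ Set.Icc (0 : ℝ) 1 := gridPt_mem (ρ t)
  have truthful := alloc_truthful (R := R) (fun k => (h.nonneg k).1) ht.1 ht.2 s l
  have spread : |alloc Q R s l - alloc Q R (1 - s) l.rev| ≤ 1 - δ :=
    abs_sub_le_of_nonneg_of_le (h.alloc_nonneg hs l) (h.alloc_le hN hs.2 l)
      (h.alloc_nonneg (one_sub_mem_unitInterval hs) l.rev)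
      (h.alloc_le hN (sub_le_self 1 hs.1) l.rev)
  have loss : |(t - s) * (alloc Q R s l - alloc Q R (1 - s) l.rev)| ≤
      1 / (2 * N) * (1 - δ) := by
    rw [abs_mul]
    exact mul_le_mul (hρ.abs_sub_le hN ht) spread (abs_nonneg _) (by positivity)
  rw [gridUtility, gridPt_rev hN]
  linarith [neg_le_of_abs_le loss]

lemma isCompetitive_roundedMechanism (hN : 0 < N) {α : ℝ} (h : LPFeasible N δ Q R lam)
    (hρ : IsRounding N ρ) (hα : 0 ≤ α) (hαlam : α ≤ lam)
    (hloss : α ≤ lam - (lam + (1 - δ)) / N) : IsCompetitive α (roundedMechanism Q R ρ) := by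
  refine isCompetitive_ofFun fun s hs t ht => ?_
  rw [hρ.symm t ht, hρ.symm s hs]
  set d := |s - t|
  set d' := |gridPt (ρ s) - gridPt (ρ t)|
  have d_le : d ≤ d' + 1 / N := hρ.abs_sub_le_add hN hs ht
  have halves : (1 - δ) * (1 / (2 * N)) + (1 - δ) * (1 / (2 * N)) = (1 - δ) / N := by
    field_simp; ring
  calc α * (1 + d) ≤ lam - (lam + (1 - δ)) / N + lam * d := by
        rw [mul_add, mul_one]
        exact add_le_add hloss (mul_le_mul_of_nonneg_right hαlam (abs_nonneg _))
    _ = (1 + (d - 1 / N)) * lam - (1 - δ) / N := by ring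
    _ ≤ (1 + d') * lam - (1 - δ) / N := by
        gcongr
        · exact hα.trans hαlam
        · linarith
    _ ≤ gridUtility Q R (ρ s) (ρ t) + gridUtility Q R (ρ t) (ρ s) - (1 - δ) / N :=
        sub_le_sub_right (h.competitive _ _) _
    _ ≤ _ := by
        linarith [h.gridUtility_sub_le hN hρ hs (ρ t), h.gridUtility_sub_le hN hρ ht (ρ s)]

end RoundedMechanism

/-! ### Existence of optimal solutions -/

section Optimal

variable {N : ℕ} {δ : ℝ}

lemma LPFeasible.variables_le (hN : 0 < N) {Q R : Fin (N + 1) → ℝ} {lam : ℝ}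
    (h : LPFeasible N δ Q R lam) :
    (∀ k, Q k ≤ 2 * (1 - δ)) ∧ (∀ k, R k ≤ 1 - δ) ∧ lam ≤ 2 * (1 - δ) := by
  have alloc_half (k : Fin (N + 1)) : Q k * (1 / 2) + R k ≤ 1 - δ := by
    have := h.alloc_le hN (show (1 / 2 : ℝ) ≤ 1 by norm_num) k
    rwa [alloc_eq, lowBasis_of_le le_rfl, highBasis_of_le le_rfl, mul_zero, add_zero] at this
  have welfare := h.competitive 0 0
  have last := h.alloc_le hN le_rfl (Fin.last N)
  rw [sub_self, abs_zero, gridUtility, gridPt_rev hN, gridPt_zero, sub_zero, Fin.rev_zero]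
    at welfare
  exact ⟨fun k => by linarith [alloc_half k, h.nonneg k],
    fun k => by linarith [alloc_half k, h.nonneg k], by linarith⟩

lemma isClosed_setOf_lpFeasible :
    IsClosed {p : (Fin (N + 1) → ℝ) × (Fin (N + 1) → ℝ) × ℝ |
      LPFeasible N δ p.1 p.2.1 p.2.2} := by
  have continuous (t : ℝ) (k : Fin (N + 1)) :
      Continuous fun p : (Fin (N + 1) → ℝ) × (Fin (N + 1) → ℝ) × ℝ => alloc p.1 p.2.1 t k := by
    simp only [alloc_eq]; fun_prop
  have eq_inter : {p : (Fin (N + 1) → ℝ) × (Fin (N + 1) → ℝ) × ℝ |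
        LPFeasible N δ p.1 p.2.1 p.2.2} =
      {p | ∀ k l, alloc p.1 p.2.1 (gridPt k) l + alloc p.1 p.2.1 (gridPt l) k ≤ 1 - δ} ∩
      {p | ∀ k l, (1 + |gridPt k - gridPt l|) * p.2.2 ≤
        gridUtility p.1 p.2.1 k l + gridUtility p.1 p.2.1 l k} ∩
      {p | ∀ k, 0 ≤ p.1 k ∧ 0 ≤ p.2.1 k} :=
    Set.ext fun p => ⟨fun ⟨h₁, h₂, h₃⟩ => ⟨⟨h₁, h₂⟩, h₃⟩, fun ⟨⟨h₁, h₂⟩, h₃⟩ => ⟨h₁, h₂, h₃⟩⟩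
  rw [eq_inter]
  simp only [Set.ofPred_forall, Set.ofPred_and, gridUtility]
  refine ((isClosed_iInter fun k => isClosed_iInter fun l => ?_).inter
    (isClosed_iInter fun k => isClosed_iInter fun l => ?_)).inter
    (isClosed_iInter fun k => IsClosed.inter ?_ ?_) <;>
    exact isClosed_le (by fun_prop) (by fun_prop)

theorem exists_lpOptimal (hN : 0 < N) {Q₀ R₀ : Fin (N + 1) → ℝ} {lam₀ : ℝ}
    (h₀ : LPFeasible N δ Q₀ R₀ lam₀) : ∃ Q R lam, LPOptimal N δ Q R lam := by
  let S := {p : (Fin (N + 1) → ℝ) × (Fin (N + 1) → ℝ) × ℝ | LPFeasible N δ p.1 p.2.1 p.2.2} ∩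
    {p | lam₀ ≤ p.2.2}
  have closed : IsClosed S :=
    isClosed_setOf_lpFeasible.inter (isClosed_le continuous_const (by fun_prop))
  have bounded : S ⊆ Set.Icc ((0 : Fin (N + 1) → ℝ), (0 : Fin (N + 1) → ℝ), lam₀)
      ((fun _ => 2 * (1 - δ)), (fun _ => 1 - δ), 2 * (1 - δ)) := by
    rintro ⟨Q, R, lam⟩ ⟨h, hlam⟩
    obtain ⟨hQ, hR, hle⟩ := h.variables_le hN
    exact ⟨⟨fun k => (h.nonneg k).1, fun k => (h.nonneg k).2, hlam⟩, hQ, hR, hle⟩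
  obtain ⟨⟨Q, R, lam⟩, ⟨h, hlam⟩, hmax⟩ := (isCompact_Icc.of_isClosed_subset closed bounded)
    |>.exists_isMaxOn ⟨(Q₀, R₀, lam₀), h₀, le_refl lam₀⟩ (f := fun p => p.2.2) (by fun_prop)
  refine ⟨Q, R, lam, h, fun Q' R' lam' h' => ?_⟩
  rcases le_total lam₀ lam' with hle | hle
  · exact hmax (show (Q', R', lam') ∈ S from ⟨h', hle⟩)
  · exact hle.trans hlam

end Optimal

/-! ### Lanewise comparison of packed vectors -/

section Pack

/-- The numbers `f 0, …, f (n - 1)` in consecutive lanes of `s + 1` bits of a single number. Lanes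
below `2 ^ s` leave the sign bit `s` free, so that one subtraction compares two vectors lane by
lane. -/
def pack (s : ℕ) (f : ℕ → ℕ) (n : ℕ) : ℕ := ∑ j ∈ range n, 2 ^ ((s + 1) * j) * f j

/-- The number whose bits are the sign bits of the lanes in a list. -/
def signBits (s : ℕ) (lanes : List ℕ) : ℕ := lanes.foldr (fun j m => 2 ^ ((s + 1) * j + s) ||| m) 0

variable {s n : ℕ} {f g : ℕ → ℕ}

lemma pack_add (f g : ℕ → ℕ) (n : ℕ) :
    pack s (fun j => f j + g j) n = pack s f n + pack s g n := by
  simp only [pack, mul_add, sum_add_distrib]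

lemma pack_const_mul (c : ℕ) (f : ℕ → ℕ) (n : ℕ) :
    pack s (fun j => c * f j) n = c * pack s f n := by
  simp only [pack, mul_sum, mul_left_comm]

lemma pack_mul_const (f : ℕ → ℕ) (c n : ℕ) :
    pack s (fun j => f j * c) n = pack s f n * c := by
  simp only [pack, sum_mul, mul_assoc]

lemma pack_const (c n : ℕ) : pack s (fun _ => c) n = c * pack s (fun _ => 1) n := by
  simpa only [mul_one] using pack_const_mul c (fun _ => 1) n

lemma pack_lt (hf : ∀ j < n, f j < 2 ^ (s + 1)) : pack s f n < 2 ^ ((s + 1) * n) := by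
  induction n with
  | zero => simp [pack]
  | succ n ih =>
    calc pack s f (n + 1) = pack s f n + 2 ^ ((s + 1) * n) * f n := sum_range_succ _ _
      _ < 2 ^ ((s + 1) * n) * (f n + 1) := by linarith [ih fun j hj => hf j (by omega)]
      _ ≤ 2 ^ ((s + 1) * n) * 2 ^ (s + 1) := Nat.mul_le_mul_left _ (hf n n.lt_succ_self)
      _ = 2 ^ ((s + 1) * (n + 1)) := by rw [← pow_add, mul_add_one]

lemma testBit_pack (hf : ∀ j < n, f j < 2 ^ (s + 1)) {j : ℕ} (hj : j < n) :
    (pack s f n).testBit ((s + 1) * j + s) = (f j).testBit s := by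
  induction n with
  | zero => omega
  | succ n ih =>
    have initial_lt := pack_lt fun j hj => hf j (Nat.lt_succ_of_lt hj)
    rw [pack, sum_range_succ, ← pack, add_comm, Nat.testBit_two_pow_mul_add _ initial_lt]
    rcases Nat.lt_succ_iff_lt_or_eq.mp hj with hj | rfl
    · have : (s + 1) * j + s < (s + 1) * n := by nlinarith
      rw [if_pos this]
      exact ih (fun j hj => hf j (by omega)) hj
    · rw [if_neg (by omega), Nat.add_sub_cancel_left]

lemma testBit_signBits_of_notMem {lanes : List ℕ} {j : ℕ} (hj : j ∉ lanes) :
    (signBits s lanes).testBit ((s + 1) * j + s) = false := by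
  induction lanes with
  | nil => simp [signBits]
  | cons i lanes ih =>
    rw [List.mem_cons, not_or] at hj
    have bit_ne : (s + 1) * i + s ≠ (s + 1) * j + s := fun h =>
      hj.1 (Nat.eq_of_mul_eq_mul_left s.succ_pos (Nat.add_right_cancel h)).symm
    have tail := ih hj.2
    rw [signBits] at tail
    rw [signBits, List.foldr_cons, Nat.testBit_or, Nat.testBit_two_pow_of_ne bit_ne, tail,
      Bool.or_false]

/-- Compares two packed vectors lane by lane, except in the given lanes: adding the sign bits first
makes each lane of the difference keep its sign bit exactly if it does not underflow. -/
def lanesLE (s : ℕ) (lanes : List ℕ) (n v w : ℕ) : Bool :=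
  (w + pack s (fun _ => 2 ^ s) n - v ||| signBits s lanes) &&& pack s (fun _ => 2 ^ s) n ==
    pack s (fun _ => 2 ^ s) n

lemma le_of_lanesLE (hf : ∀ j < n, f j < 2 ^ s) (hg : ∀ j < n, g j < 2 ^ s) {lanes : List ℕ}
    (h : lanesLE s lanes n (pack s f n) (pack s g n)) {j : ℕ} (hj : j < n)
    (hj' : j ∉ lanes) : f j ≤ g j := by
  have difference : pack s g n + pack s (fun _ => 2 ^ s) n - pack s f n =
      pack s (fun j => g j + 2 ^ s - f j) n := by
    have le_add (j : ℕ) (hj : j ∈ range n) : f j ≤ g j + 2 ^ s :=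
      (hf j (mem_range.1 hj)).le.trans (Nat.le_add_left _ _)
    rw [Nat.sub_eq_iff_eq_add, ← pack_add, ← pack_add]
    · exact sum_congr rfl fun j hj => congrArg _ (Nat.sub_add_cancel (le_add j hj)).symm
    · rw [← pack_add]
      exact sum_le_sum fun j hj => Nat.mul_le_mul_left _ (le_add j hj)
  have bit := congrArg (fun x => x.testBit ((s + 1) * j + s)) (beq_iff_eq.1 h)
  have sign_lt : 2 ^ s < 2 ^ (s + 1) := by rw [pow_succ]; linarith [Nat.two_pow_pos s]
  simp only [Nat.testBit_and, Nat.testBit_or, testBit_signBits_of_notMem hj', Bool.or_false] at bit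
  rw [difference, testBit_pack (fun _ _ => sign_lt) hj, Nat.testBit_two_pow_self, Bool.and_true,
    testBit_pack (fun j hj => by have := hg j hj; rw [pow_succ]; omega) hj] at bit
  have := Nat.ge_two_pow_of_testBit bit
  omega

end Pack

/-! ### A nearly optimal rational solution -/

/-- Linear interpolation between `(a, x)` and `(b, y)`, from units of `10⁻¹⁰` to `10⁻¹⁸`. -/
def lerp (a x b y k : ℕ) : ℕ := 10 ^ 8 * (x * (b - k) + y * (k - a)) / (b - a)

/-- Piecewise linear interpolation of two functions given at the knots of a list. -/
def interp : ℕ → ℕ → ℕ → List (ℕ × ℕ × ℕ) → ℕ → ℕ × ℕ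
  | _, x, y, [], _ => (x, y)
  | a, x, y, (b, x', y') :: l, k =>
    bif Nat.ble b k then interp b x' y' l k else (lerp a x b x' k, lerp a y b y' k)

/-- The knots `(k, Q, R)` of the piecewise linear part of the solution, in units of `10⁻¹⁰`. -/
def knots : List (ℕ × ℕ × ℕ) :=
  [(0, 7599916507, 4993213754), (120, 8054867235, 4019099312), (160, 10498664151, 2644630932),
   (240, 14310061971, 379870312), (280, 14383409281, 90027), (300, 14145332416, 0),
   (360, 12980239022, 0), (367, 12450120022, 163358043), (369, 12388304495, 184748005),
   (501, 9689827460, 149), (560, 8652114456, 56859), (600, 7727050981, 133658636),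
   (620, 7162472882, 244030828), (631, 6877722109, 293975900), (633, 6870370853, 276851144),
   (640, 6477945127, 339819962), (660, 6099987455, 364325225), (687, 5622007567, 365469744),
   (700, 5423560064, 349888883), (720, 5323719821, 249026618), (760, 4974239853, 212535880),
   (780, 5179406270, 174294373), (800, 5364541755, 142651483), (808, 5434795526, 130839783),
   (840, 5714001805, 84046185), (860, 5953031853, 63948269), (880, 6202655981, 36312599),
   (920, 6142724435, 96349), (980, 6160210266, 32296), (1000, 6173555712, 1224)]

/-- The entries `(k, Q, R)` at the grid points that occur in the binding constraints. -/
def coreTable : List (ℕ × ℕ × ℕ) :=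
  [(0, 760054348654619022, 499269999999995000), (193, 1207097259230785313, 171037939463403179),
   (311, 1393173257789632013, 0), (312, 1391231435467412244, 0),
   (368, 1242395987900000000, 17925480000000000), (500, 970911161109884224, 0),
   (632, 684556633400000000, 29873220313446671), (688, 561014280400000000, 36258159174455131),
   (689, 559381331200000000, 36191518507556262), (807, 542599014206100533, 13231183663305795),
   (1000, 617367674366218318, 0)]

/-- The nearly optimal coefficients at the grid point `k / 1000`. -/
def table (k : ℕ) : ℕ × ℕ := (coreTable.lookup k).getD (interp 0 0 0 knots k)

/-- `10 ^ 18 * Q` at the grid point `k / 1000`, for the nearly optimal solution. -/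
def qTab (k : ℕ) : ℕ := (table k).1

/-- `10 ^ 18 * R` at the grid point `k / 1000`, for the nearly optimal solution. -/
def rTab (k : ℕ) : ℕ := (table k).2

/-- The value attained by the nearly optimal solution, in units of `10⁻¹⁸`. -/
def lamTab : ℕ := 835524290631156855

/-- An upper bound, in units of `10⁻¹⁸`, for the optimal value of the linear program. -/
def lamUpper : ℕ := 835524290631256855

/-- `2 (x + x³ / 3 + x⁵ / 5)` for `x = 1 / (2 m + 1)`, rounded down in units of `10⁻¹⁸`: a lower
approximation of `log ((m + 1) / m) = 2 artanh x`. -/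
def logStep (m : ℕ) : ℕ :=
  2 * 10 ^ 18 * (15 * (2 * m + 1) ^ 4 + 5 * (2 * m + 1) ^ 2 + 3) / (15 * (2 * m + 1) ^ 5)

/-- A lower approximation of `log ((500 + n) / 500)`, in units of `10⁻¹⁸`. -/
def logTab : ℕ → ℕ
  | 0 => 0
  | n + 1 => logTab n + logStep (500 + n)

/-- `lowBasis (k / 1000)` in units of `10⁻¹⁸`. -/
def lowTab (k : ℕ) : ℕ := 10 ^ 15 * min k 500

/-- A lower approximation of `highBasis (k / 1000)` in units of `10⁻¹⁸`; the truncated subtraction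
`k - 500` makes it vanish for `k ≤ 500`. -/
def highTab (k : ℕ) : ℕ := logTab (k - 500) - (k - 500) * 10 ^ 15

/-- A lower approximation of `A(k / 1000, l / 1000)` in units of `10⁻³⁶`. -/
def allocTab (k l : ℕ) : ℕ :=
  lowTab k * qTab l + 10 ^ 18 * rTab l + highTab k * qTab (1000 - l)

/-- A lower approximation of `û(k / 1000, l / 1000)` in units of `10⁻³⁹`. -/
def utilityTab (k l : ℕ) : ℕ :=
  k * allocTab k l + (1000 - k) * allocTab (1000 - k) (1000 - l)

lemma qTab_le : ∀ k < 1001, qTab k ≤ 144 * 10 ^ 16 := by decide +kernel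

lemma rTab_le : ∀ k < 1001, rTab k ≤ 10 ^ 18 := by decide +kernel

lemma highTab_le : ∀ k < 1001, highTab k ≤ 5 * 10 ^ 17 := by decide +kernel

lemma lowTab_le (k : ℕ) : lowTab k ≤ 5 * 10 ^ 17 :=
  Nat.mul_le_mul_left _ (min_le_right k 500)

lemma allocTab_le {k l : ℕ} (hk : k < 1001) (hl : l < 1001) : allocTab k l ≤ 3 * 10 ^ 36 := by
  have low := Nat.mul_le_mul (lowTab_le k) (qTab_le l hl)
  have high := Nat.mul_le_mul (highTab_le k hk) (qTab_le (1000 - l) (by omega))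
  have := rTab_le l hl
  rw [allocTab]
  omega

lemma utilityTab_le {k l : ℕ} (hk : k < 1001) (hl : l < 1001) : utilityTab k l ≤ 3 * 10 ^ 39 := by
  have first := Nat.mul_le_mul_left k (allocTab_le hk hl)
  have second := Nat.mul_le_mul_left (1000 - k)
    (allocTab_le (k := 1000 - k) (l := 1000 - l) (by omega) (by omega))
  rw [utilityTab]
  omega

/-- The pairs `(k, l)` whose feasibility constraint is binding at the optimum. -/
def bindingFeasible : List (Fin (1000 + 1) × Fin (1000 + 1)) :=
  [(0, 0), (500, 311), (500, 312), (689, 689), (807, 0), (807, 688), (1000, 0), (1000, 193),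
   (1000, 632)]

/-- The pairs `(k, l)` whose welfare constraint is binding at the optimum. -/
def bindingWelfare : List (Fin (1000 + 1) × Fin (1000 + 1)) :=
  [(193, 0), (311, 0), (312, 0), (368, 0), (500, 193)]

/-- The closure of a list of pairs under the exchange of the agents. -/
def swapClosure {α : Type*} (pairs : List (α × α)) : List (α × α) := pairs ++ pairs.map Prod.swap

/-- The closure of a list of pairs of grid points under the exchange of the items. -/
def revClosure {n : ℕ} (pairs : List (Fin n × Fin n)) : List (Fin n × Fin n) :=
  pairs ++ pairs.map (Prod.map Fin.rev Fin.rev)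

/-- The second components of the pairs with first component `k`. -/
def rowOf {n : ℕ} (pairs : List (Fin n × Fin n)) (k : ℕ) : List ℕ :=
  (pairs.filter (·.1.val == k)).map (·.2.val)

lemma mem_swapClosure {α : Type*} {pairs : List (α × α)} {a b : α} :
    (a, b) ∈ swapClosure pairs ↔ (a, b) ∈ pairs ∨ (b, a) ∈ pairs := by
  simp [swapClosure]

lemma mem_revClosure {n : ℕ} {pairs : List (Fin n × Fin n)} {k l : Fin n} :
    (k, l) ∈ revClosure pairs ↔ (k, l) ∈ pairs ∨ (k.rev, l.rev) ∈ pairs := by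
  simp [revClosure, Fin.rev_eq_iff]

lemma val_mem_rowOf {n : ℕ} {pairs : List (Fin n × Fin n)} {k l : Fin n} :
    l.val ∈ rowOf pairs k ↔ (k, l) ∈ pairs := by
  simp [rowOf, Fin.val_inj]

/-- A vector indexed by the grid, packed in lanes of 160 bits. -/
def packGrid (f : ℕ → ℕ) : ℕ := pack 159 f 1001

/-- The packed form of a row of `allocTab`, with columns selected by `σ` and scaled by `c`. -/
def packedRow (c k : ℕ) (σ : ℕ → ℕ) : ℕ :=
  c * (lowTab k * packGrid (fun l => qTab (σ l)) + 10 ^ 18 * packGrid (fun l => rTab (σ l)) +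
    highTab k * packGrid (fun l => qTab (1000 - σ l)))

/-- The packed form of a column of `allocTab`, with rows selected by `σ` and scaled by `w`. -/
def packedColumn (w : ℕ → ℕ) (k : ℕ) (σ : ℕ → ℕ) : ℕ :=
  packGrid (fun l => w l * lowTab (σ l)) * qTab k + packGrid w * (10 ^ 18 * rTab k) +
    packGrid (fun l => w l * highTab (σ l)) * qTab (1000 - k)

lemma packGrid_row (c k : ℕ) (σ : ℕ → ℕ) :
    packGrid (fun l => c * allocTab k (σ l)) = packedRow c k σ := by
  simp only [packGrid, packedRow, allocTab, pack_const_mul, pack_add]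

lemma packGrid_column (w : ℕ → ℕ) (k : ℕ) (σ : ℕ → ℕ) :
    packGrid (fun l => w l * allocTab (σ l) k) = packedColumn w k σ := by
  simp only [packGrid, packedColumn, allocTab, mul_add, ← mul_assoc, pack_mul_const, pack_add]

/-- The feasibility constraints of row `k` hold with slack `5 * 10⁻⁹` off the binding pairs. -/
def feasibilityRow (k : ℕ) : Bool :=
  lanesLE 159 (rowOf (swapClosure bindingFeasible) k) 1001
    (packedRow 1 k (fun l => l) + packedColumn (fun _ => 1) k (fun l => l) +
      5 * 10 ^ 27 * packGrid fun _ => 1)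
    (99854 * 10 ^ 31 * packGrid fun _ => 1)

/-- The welfare constraints of row `k` for the value `lamUpper`, with `k - l` in place of `|k - l|`,
hold with slack `5 * 10⁻⁹` off the binding pairs. -/
def welfareRow (k : ℕ) : Bool :=
  lanesLE 159 (rowOf (revClosure (swapClosure bindingWelfare)) k) 1001
    ((lamUpper * 10 ^ 18 * (1000 + k) + 5 * 10 ^ 30) * packGrid fun _ => 1)
    (packedRow k k (fun l => l) + packedRow (1000 - k) (1000 - k) (fun l => 1000 - l) +
      (packedColumn (fun l => l) k (fun l => l) +
        packedColumn (fun l => 1000 - l) (1000 - k) (fun l => 1000 - l)) +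
      lamUpper * 10 ^ 18 * packGrid fun l => l)

lemma feasibilityRow_eq_true : ∀ k < 1001, feasibilityRow k := by decide +kernel

lemma welfareRow_eq_true : ∀ k < 1001, welfareRow k := by decide +kernel

lemma allocTab_add_le {k l : Fin (1000 + 1)}
    (h : (k, l) ∉ swapClosure bindingFeasible) :
    allocTab k l + allocTab l k + 5 * 10 ^ 27 ≤ 99854 * 10 ^ 31 := by
  refine le_of_lanesLE (s := 159) (n := 1001)
    (f := fun l => allocTab k l + allocTab l k + 5 * 10 ^ 27) (g := fun _ => 99854 * 10 ^ 31)
    (lanes := rowOf (swapClosure bindingFeasible) k) (fun l hl => ?_) (fun _ _ => by norm_num)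
    ?_ l.isLt (mt val_mem_rowOf.1 h)
  · have := allocTab_le k.isLt hl
    have := allocTab_le hl k.isLt
    omega
  · have row := packGrid_row 1 k fun l => l
    have column := packGrid_column (fun _ => 1) k fun l => l
    simp only [packGrid, one_mul] at row column
    rw [pack_add, pack_add, pack_const (5 * 10 ^ 27), pack_const (99854 * 10 ^ 31), row, column]
    simpa only [feasibilityRow, packGrid] using feasibilityRow_eq_true k k.isLt

lemma le_utilityTab_add {k l : Fin (1000 + 1)}
    (h : (k, l) ∉ revClosure (swapClosure bindingWelfare)) :
    lamUpper * 10 ^ 18 * (1000 + k) + 5 * 10 ^ 30 ≤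
      utilityTab k l + utilityTab l k + lamUpper * 10 ^ 18 * l := by
  refine le_of_lanesLE (s := 159) (n := 1001)
    (f := fun _ => lamUpper * 10 ^ 18 * (1000 + k) + 5 * 10 ^ 30)
    (g := fun l => utilityTab k l + utilityTab l k + lamUpper * 10 ^ 18 * l)
    (lanes := rowOf (revClosure (swapClosure bindingWelfare)) k)
    (fun _ _ => ?_) (fun l hl => ?_) ?_ l.isLt (mt val_mem_rowOf.1 h)
  · rw [lamUpper]
    omega
  · have := utilityTab_le k.isLt hl
    have := utilityTab_le hl k.isLt
    rw [lamUpper]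
    omega
  · have row := packGrid_row k k fun l => l
    have row_rev := packGrid_row (1000 - k) (1000 - k) fun l => 1000 - l
    have column := packGrid_column (fun l => l) k fun l => l
    have column_rev := packGrid_column (fun l => 1000 - l) (1000 - k) fun l => 1000 - l
    simp only [packGrid] at row row_rev column column_rev
    simp only [utilityTab]
    rw [pack_const (_ + _), pack_add, pack_add, pack_add, pack_add, pack_const_mul (_ * _), row,
      row_rev, column, column_rev]
    simpa only [welfareRow, packGrid] using welfareRow_eq_true k k.isLt

/-! ### Accuracy of the tables -/

/-- `∑ x ^ (2 i + 1) / (2 i + 1)` over `i < 3` at `x = 1 / (2 m + 1)`, whose double approximates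
`log ((m + 1) / m)`. -/
noncomputable def artanhSum (m : ℕ) : ℝ :=
  (15 * (2 * m + 1) ^ 4 + 5 * (2 * m + 1) ^ 2 + 3) / (15 * (2 * m + 1) ^ 5)

lemma artanhSum_eq_sum (m : ℕ) :
    ∑ i ∈ range 3, (1 / (2 * m + 1) : ℝ) ^ (2 * i + 1) / (2 * i + 1) = artanhSum m := by
  have : (2 * m + 1 : ℝ) ≠ 0 := by positivity
  simp only [sum_range_succ, range_zero, sum_empty, artanhSum]
  push_cast
  field_simp
  ring

lemma one_add_div_one_sub {m : ℕ} (hm : 0 < m) :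
    (1 + 1 / (2 * m + 1 : ℝ)) / (1 - 1 / (2 * m + 1)) = (m + 1) / m := by
  have : (0 : ℝ) < m := Nat.cast_pos.2 hm
  have : (1 : ℝ) - 1 / (2 * m + 1) ≠ 0 :=
    (sub_pos.2 ((div_lt_one (by positivity)).2 (by linarith))).ne'
  field_simp
  ring

lemma two_mul_artanhSum_le_log {m : ℕ} (hm : 0 < m) :
    2 * artanhSum m ≤ Real.log ((m + 1) / m) := by
  have : (1 : ℝ) ≤ m := Nat.one_le_cast.2 hm
  have le := Real.sum_range_le_log_div (x := 1 / (2 * m + 1)) (by positivity)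
    ((div_lt_one (by positivity)).2 (by linarith)) 3
  rw [artanhSum_eq_sum, one_add_div_one_sub hm] at le
  linarith

lemma log_le_two_mul_artanhSum_add {m : ℕ} (hm : 500 ≤ m) :
    Real.log ((m + 1) / m) ≤ 2 * artanhSum m + 1 / 10 ^ 18 := by
  have : (500 : ℝ) ≤ m := by exact_mod_cast hm
  set x : ℝ := 1 / (2 * m + 1) with hx
  have x_nonneg : 0 ≤ x := by positivity
  have x_le : x ≤ 1 / 1001 := one_div_le_one_div_of_le (by norm_num) (by linarith)
  have le := Real.log_div_le_sum_range_add x_nonneg (x_le.trans_lt (by norm_num)) 3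
  rw [hx, artanhSum_eq_sum, one_add_div_one_sub (by omega), ← hx] at le
  have tail : x ^ (2 * 3 + 1) / (1 - x ^ 2) ≤ (1 / 1001) ^ (2 * 3 + 1) / (1 - (1 / 1001) ^ 2) := by
    gcongr
  norm_num at tail le ⊢
  linarith

lemma logStep_eq_floor (m : ℕ) : logStep m = ⌊2 * 10 ^ 18 * artanhSum m⌋₊ := by
  rw [logStep, ← Nat.floor_div_eq_div (K := ℝ), artanhSum, ← mul_div_assoc]
  norm_num

lemma logStep_le {m : ℕ} (hm : 0 < m) : (logStep m : ℝ) ≤ 10 ^ 18 * Real.log ((m + 1) / m) := by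
  have floor_le := Nat.floor_le (show 0 ≤ 2 * 10 ^ 18 * artanhSum m by rw [artanhSum]; positivity)
  rw [← logStep_eq_floor] at floor_le
  linarith [two_mul_artanhSum_le_log hm]

lemma log_le_logStep_add {m : ℕ} (hm : 500 ≤ m) :
    10 ^ 18 * Real.log ((m + 1) / m) ≤ logStep m + 2 := by
  have lt_floor := Nat.lt_floor_add_one (2 * 10 ^ 18 * artanhSum m)
  rw [← logStep_eq_floor] at lt_floor
  linarith [log_le_two_mul_artanhSum_add hm]

lemma log_succ (n : ℕ) : Real.log ((500 + (n + 1 : ℕ)) / 500) = Real.log ((500 + n) / 500) +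
    Real.log (((500 + n : ℕ) + 1) / (500 + n : ℕ)) := by
  rw [← Real.log_mul (by positivity) (by positivity)]
  congr 1
  push_cast
  field_simp
  ring

lemma logTab_le (n : ℕ) : (logTab n : ℝ) ≤ 10 ^ 18 * Real.log ((500 + n) / 500) := by
  induction n with
  | zero => simp [logTab]
  | succ n ih =>
    have step := logStep_le (m := 500 + n) (by omega)
    rw [log_succ, logTab, Nat.cast_add]
    linarith

lemma log_le_logTab_add (n : ℕ) : 10 ^ 18 * Real.log ((500 + n) / 500) ≤ logTab n + 2 * n := by
  induction n with
  | zero => simp [logTab]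
  | succ n ih =>
    have step := log_le_logStep_add (m := 500 + n) (by omega)
    rw [log_succ, logTab]
    push_cast at step ⊢
    linarith

lemma mul_le_logTab : ∀ n < 501, n * 10 ^ 15 ≤ logTab n := by decide +kernel

lemma highTab_eq_sub {k : ℕ} (hk : k < 1001) :
    (highTab k : ℝ) = logTab (k - 500) - (k - 500 : ℕ) * 10 ^ 15 := by
  unfold highTab
  rw [Nat.cast_sub (mul_le_logTab _ (by omega)), Nat.cast_mul, Nat.cast_pow, Nat.cast_ofNat]

lemma highBasis_eq_log_sub (k : ℕ) : highBasis (k / 1000) =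
    Real.log ((500 + (k - 500 : ℕ)) / 500) - (k - 500 : ℕ) / 1000 := by
  obtain hk | hk := le_total k 500
  · have : (k : ℝ) ≤ 500 := by exact_mod_cast hk
    rw [highBasis_of_le (by linarith), Nat.sub_eq_zero_of_le hk]
    norm_num
  · have : (500 : ℝ) ≤ k := by exact_mod_cast hk
    rw [highBasis_of_ge (by linarith), f₂, Nat.cast_sub hk]
    push_cast
    rw [show 2 * ((k : ℝ) / 1000) = (500 + (k - 500)) / 500 by ring]
    ring

lemma highTab_le_highBasis {k : ℕ} (hk : k < 1001) :
    (highTab k : ℝ) ≤ 10 ^ 18 * highBasis (k / 1000) := by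
  rw [highTab_eq_sub hk, highBasis_eq_log_sub]
  linarith [logTab_le (k - 500)]

lemma highBasis_le_highTab_add {k : ℕ} (hk : k < 1001) :
    10 ^ 18 * highBasis (k / 1000) ≤ highTab k + 1000 := by
  have : ((k - 500 : ℕ) : ℝ) ≤ 500 := by exact_mod_cast (by omega : k - 500 ≤ 500)
  rw [highTab_eq_sub hk, highBasis_eq_log_sub]
  linarith [log_le_logTab_add (k - 500)]

lemma lowTab_eq_lowBasis (k : ℕ) : (lowTab k : ℝ) = 10 ^ 18 * lowBasis (k / 1000) := by
  obtain hk | hk := le_total k 500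
  · have : (k : ℝ) ≤ 500 := by exact_mod_cast hk
    rw [lowBasis_of_le (by linarith), lowTab, min_eq_left hk, Nat.cast_mul, Nat.cast_pow,
      Nat.cast_ofNat]
    ring
  · have : (500 : ℝ) ≤ k := by exact_mod_cast hk
    rw [lowBasis_of_ge (by linarith), lowTab, min_eq_right hk]
    norm_num

/-! ### The binding constraints suffice near the table -/

/-- The coefficient vector `Q` of the nearly optimal solution. -/
noncomputable def tableQ (k : Fin (1000 + 1)) : ℝ := qTab k / 10 ^ 18

/-- The coefficient vector `R` of the nearly optimal solution. -/
noncomputable def tableR (k : Fin (1000 + 1)) : ℝ := rTab k / 10 ^ 18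

lemma gridPt_eq_div (k : Fin (1000 + 1)) : gridPt k = (k : ℕ) / 1000 := by
  simp [gridPt]

/-- The allocation at the grid point `k / 1000`, with the values of `highBasis` replaced by their
rational lower approximations. -/
noncomputable def approxAlloc (Q R : Fin (1000 + 1) → ℝ) (k l : Fin (1000 + 1)) : ℝ :=
  Q l * (lowTab k / 10 ^ 18) + R l + Q l.rev * (highTab k / 10 ^ 18)

/-- The utility `gridUtility`, with `approxAlloc` in place of the allocation. -/
noncomputable def approxUtility (Q R : Fin (1000 + 1) → ℝ) (k l : Fin (1000 + 1)) : ℝ :=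
  gridPt k * approxAlloc Q R k l + (1 - gridPt k) * approxAlloc Q R k.rev l.rev

variable {Q R : Fin (1000 + 1) → ℝ} {lam : ℝ}

lemma alloc_gridPt_eq (k l : Fin (1000 + 1)) : alloc Q R (gridPt k) l =
    approxAlloc Q R k l + Q l.rev * (highBasis ((k : ℕ) / 1000) - highTab k / 10 ^ 18) := by
  rw [alloc_eq, approxAlloc, gridPt_eq_div, lowTab_eq_lowBasis]
  ring

lemma approxAlloc_le_alloc (hQ : ∀ k, 0 ≤ Q k) (k l : Fin (1000 + 1)) :
    approxAlloc Q R k l ≤ alloc Q R (gridPt k) l := by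
  rw [alloc_gridPt_eq]
  exact le_add_of_nonneg_right
    (mul_nonneg (hQ _) (by linarith [highTab_le_highBasis k.isLt]))

lemma alloc_le_approxAlloc_add (hQ : ∀ k, 0 ≤ Q k) (hQ2 : ∀ k, Q k ≤ 2) (k l : Fin (1000 + 1)) :
    alloc Q R (gridPt k) l ≤ approxAlloc Q R k l + 2 / 10 ^ 15 := by
  have error_le : highBasis ((k : ℕ) / 1000) - highTab k / 10 ^ 18 ≤ 1 / 10 ^ 15 := by
    linarith [highBasis_le_highTab_add k.isLt]
  rw [alloc_gridPt_eq]
  nlinarith [hQ l.rev, hQ2 l.rev]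

lemma approxUtility_le_gridUtility (hQ : ∀ k, 0 ≤ Q k) (k l : Fin (1000 + 1)) :
    approxUtility Q R k l ≤ gridUtility Q R k l := by
  obtain ⟨h0, h1⟩ := gridPt_mem k
  have := sub_nonneg.2 h1
  rw [approxUtility, gridUtility]
  gcongr
  · exact approxAlloc_le_alloc hQ k l
  · exact approxAlloc_le_alloc hQ k.rev l.rev

lemma gridUtility_le_approxUtility_add (hQ : ∀ k, 0 ≤ Q k) (hQ2 : ∀ k, Q k ≤ 2)
    (k l : Fin (1000 + 1)) : gridUtility Q R k l ≤ approxUtility Q R k l + 2 / 10 ^ 15 := by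
  obtain ⟨h0, h1⟩ := gridPt_mem k
  have direct := alloc_le_approxAlloc_add (R := R) hQ hQ2 k l
  have reflected := alloc_le_approxAlloc_add (R := R) hQ hQ2 k.rev l.rev
  rw [approxUtility, gridUtility]
  nlinarith

lemma tableQ_nonneg (k : Fin (1000 + 1)) : 0 ≤ tableQ k := by
  unfold tableQ
  positivity

lemma tableR_nonneg (k : Fin (1000 + 1)) : 0 ≤ tableR k := by
  unfold tableR
  positivity

lemma tableQ_le (k : Fin (1000 + 1)) : tableQ k ≤ 1.44 := by
  have q_le : (qTab k : ℝ) ≤ 144 * 10 ^ 16 := by exact_mod_cast qTab_le k k.isLt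
  rw [tableQ]
  linarith

lemma approxAlloc_table (k l : Fin (1000 + 1)) :
    10 ^ 36 * approxAlloc tableQ tableR k l = allocTab k l := by
  rw [approxAlloc, allocTab, tableQ, tableQ, tableR, Fin.val_rev, Nat.add_sub_add_right]
  push_cast
  ring

lemma approxUtility_table (k l : Fin (1000 + 1)) :
    10 ^ 39 * approxUtility tableQ tableR k l = utilityTab k l := by
  have direct := approxAlloc_table k l
  have reflected := approxAlloc_table k.rev l.rev
  rw [Fin.val_rev, Fin.val_rev, Nat.add_sub_add_right, Nat.add_sub_add_right] at reflected
  rw [utilityTab, Nat.cast_add, Nat.cast_mul, Nat.cast_mul, Nat.cast_sub k.is_le, ← direct,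
    ← reflected, approxUtility, gridPt_eq_div, Nat.cast_ofNat]
  ring

lemma alloc_table_le (k l : Fin (1000 + 1)) :
    alloc tableQ tableR (gridPt k) l ≤ allocTab k l / 10 ^ 36 + 2 / 10 ^ 15 := by
  rw [← approxAlloc_table, mul_div_cancel_left₀ _ (by positivity)]
  exact alloc_le_approxAlloc_add tableQ_nonneg (fun k => (tableQ_le k).trans (by norm_num)) k l

lemma le_gridUtility_table (k l : Fin (1000 + 1)) :
    utilityTab k l / 10 ^ 39 ≤ gridUtility tableQ tableR k l := by
  rw [← approxUtility_table, mul_div_cancel_left₀ _ (by positivity)]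
  exact approxUtility_le_gridUtility tableQ_nonneg k l

/-- `Q` and `R` agree with the nearly optimal solution up to `10⁻⁹`, which is less than the slack
of its nonbinding constraints. -/
structure NearTable (Q R : Fin (1000 + 1) → ℝ) : Prop where
  abs_Q_sub_le : ∀ k, |Q k - tableQ k| ≤ 1 / 10 ^ 9
  abs_R_sub_le : ∀ k, |R k - tableR k| ≤ 1 / 10 ^ 9

/-- The constraints of the linear program that are binding at the optimum, together with the
nonnegativity of all variables. -/
structure BindingConstraints (Q R : Fin (1000 + 1) → ℝ) (lam : ℝ) : Prop where
  feasible : ∀ k l, (k, l) ∈ bindingFeasible →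
    alloc Q R (gridPt k) l + alloc Q R (gridPt l) k ≤ 1 - 2.92 / 2000
  competitive : ∀ k l, (k, l) ∈ bindingWelfare →
    (1 + |gridPt k - gridPt l|) * lam ≤ gridUtility Q R k l + gridUtility Q R l k
  nonneg : ∀ k, 0 ≤ Q k ∧ 0 ≤ R k

lemma NearTable.abs_alloc_sub_le (h : NearTable Q R) (k l : Fin (1000 + 1)) :
    |alloc Q R (gridPt k) l - alloc tableQ tableR (gridPt k) l| ≤ 2 / 10 ^ 9 :=
  (abs_alloc_sub_alloc_le h.abs_Q_sub_le h.abs_R_sub_le (gridPt_mem k).1 (gridPt_mem k).2 l).trans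
    (by norm_num)

lemma NearTable.gridUtility_sub_le (h : NearTable Q R) (k l : Fin (1000 + 1)) :
    gridUtility tableQ tableR k l - 2 / 10 ^ 9 ≤ gridUtility Q R k l := by
  obtain ⟨h0, h1⟩ := gridPt_mem k
  have direct := (abs_le.1 (h.abs_alloc_sub_le k l)).1
  have reflected := (abs_le.1 (h.abs_alloc_sub_le k.rev l.rev)).1
  rw [gridUtility, gridUtility]
  nlinarith

lemma NearTable.alloc_add_alloc_le (h : NearTable Q R) {k l : Fin (1000 + 1)}
    (hkl : (k, l) ∉ swapClosure bindingFeasible) :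
    alloc Q R (gridPt k) l + alloc Q R (gridPt l) k ≤ 1 - 2.92 / 2000 := by
  have slack : (allocTab k l + allocTab l k + 5 * 10 ^ 27 : ℝ) ≤ 99854 * 10 ^ 31 := by
    exact_mod_cast allocTab_add_le hkl
  linarith [alloc_table_le k l, alloc_table_le l k,
    (abs_le.1 (h.abs_alloc_sub_le k l)).2, (abs_le.1 (h.abs_alloc_sub_le l k)).2]

lemma NearTable.le_gridUtility_add (h : NearTable Q R) {k l : Fin (1000 + 1)}
    (hkl : (k, l) ∉ revClosure (swapClosure bindingWelfare)) :
    (1 + (gridPt k - gridPt l)) * (lamUpper / 10 ^ 18) ≤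
      gridUtility Q R k l + gridUtility Q R l k := by
  have slack : (lamUpper * 10 ^ 18 * (1000 + k) + 5 * 10 ^ 30 : ℝ) ≤
      utilityTab k l + utilityTab l k + lamUpper * 10 ^ 18 * l := by
    exact_mod_cast le_utilityTab_add hkl
  rw [gridPt_eq_div, gridPt_eq_div]
  linarith [le_gridUtility_table k l, le_gridUtility_table l k,
    h.gridUtility_sub_le k l, h.gridUtility_sub_le l k]

lemma gridUtility_rev (k l : Fin (1000 + 1)) :
    gridUtility Q R k.rev l.rev = gridUtility Q R k l := by
  rw [gridUtility, gridUtility, gridPt_rev (by norm_num), Fin.rev_rev, Fin.rev_rev]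
  ring

lemma BindingConstraints.feasible_of_mem (h : BindingConstraints Q R lam) {k l : Fin (1000 + 1)}
    (hkl : (k, l) ∈ swapClosure bindingFeasible) :
    alloc Q R (gridPt k) l + alloc Q R (gridPt l) k ≤ 1 - 2.92 / 2000 := by
  rcases mem_swapClosure.1 hkl with hkl | hkl
  · exact h.feasible k l hkl
  · rw [add_comm]
    exact h.feasible l k hkl

lemma BindingConstraints.competitive_of_mem (h : BindingConstraints Q R lam)
    {k l : Fin (1000 + 1)} (hkl : (k, l) ∈ revClosure (swapClosure bindingWelfare)) :
    (1 + |gridPt k - gridPt l|) * lam ≤ gridUtility Q R k l + gridUtility Q R l k := by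
  wlog hkl' : (k, l) ∈ swapClosure bindingWelfare generalizing k l
  · have mirrored := (mem_revClosure.1 hkl).resolve_left hkl'
    have := this (mem_revClosure.2 (.inl mirrored)) mirrored
    rwa [gridUtility_rev, gridUtility_rev, gridPt_rev (by norm_num), gridPt_rev (by norm_num),
      sub_sub_sub_cancel_left, abs_sub_comm] at this
  rcases mem_swapClosure.1 hkl' with hkl' | hkl'
  · exact h.competitive k l hkl'
  · rw [abs_sub_comm, add_comm (gridUtility Q R k l)]
    exact h.competitive l k hkl'

theorem BindingConstraints.lpFeasible (h : BindingConstraints Q R lam) (hnear : NearTable Q R)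
    (hlam : lam ≤ lamUpper / 10 ^ 18) : LPFeasible 1000 (2.92 / 2000) Q R lam where
  feasible k l := by
    by_cases hkl : (k, l) ∈ swapClosure bindingFeasible
    · exact h.feasible_of_mem hkl
    · exact hnear.alloc_add_alloc_le hkl
  competitive k l := by
    wlog hle : gridPt l ≤ gridPt k generalizing k l
    · rw [abs_sub_comm, add_comm (gridUtility Q R k l)]
      exact this l k (not_le.1 hle).le
    by_cases hkl : (k, l) ∈ revClosure (swapClosure bindingWelfare)
    · exact h.competitive_of_mem hkl
    · rw [abs_of_nonneg (sub_nonneg.2 hle)]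
      exact (mul_le_mul_of_nonneg_left hlam (by linarith)).trans (hnear.le_gridUtility_add hkl)
  nonneg := h.nonneg

/-! ### The binding constraints determine the optimum -/

lemma allocTab_binding : ∀ p ∈ bindingFeasible,
    99854 * 10 ^ 31 ≤ allocTab p.1 p.2 + allocTab p.2 p.1 + 11 * 10 ^ 21 ∧
      allocTab p.1 p.2 + allocTab p.2 p.1 + 4 * 10 ^ 21 ≤ 99854 * 10 ^ 31 :=
  List.all_iff_forall_prop.1 (by decide +kernel)

lemma utilityTab_binding : ∀ p ∈ bindingWelfare,
    lamTab * 10 ^ 18 * (1000 + p.1) ≤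
        utilityTab p.1 p.2 + utilityTab p.2 p.1 + lamTab * 10 ^ 18 * p.2 ∧
      utilityTab p.1 p.2 + utilityTab p.2 p.1 + lamTab * 10 ^ 18 * p.2 ≤
        lamTab * 10 ^ 18 * (1000 + p.1) + 10 ^ 25 :=
  List.all_iff_forall_prop.1 (by decide +kernel)

lemma abs_gridPt_sub_of_mem :
    ∀ p ∈ bindingWelfare, |gridPt p.1 - gridPt p.2| = gridPt p.1 - gridPt p.2 := by
  have le_of_mem : ∀ p ∈ bindingWelfare, p.2 ≤ p.1 := by simp [bindingWelfare]
  intro p hp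
  rw [gridPt_eq_div, gridPt_eq_div]
  have : ((p.2 : ℕ) : ℝ) ≤ (p.1 : ℕ) := by exact_mod_cast le_of_mem p hp
  exact abs_of_nonneg (by linarith)

theorem lpFeasible_table : LPFeasible 1000 (2.92 / 2000) tableQ tableR (lamTab / 10 ^ 18) := by
  refine BindingConstraints.lpFeasible ⟨fun k l hkl => ?_, fun k l hkl => ?_, fun k =>
    ⟨tableQ_nonneg k, tableR_nonneg k⟩⟩ ⟨fun k => ?_, fun k => ?_⟩ ?_
  · have slack : (allocTab k l + allocTab l k + 4 * 10 ^ 21 : ℝ) ≤ 99854 * 10 ^ 31 := by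
      exact_mod_cast (allocTab_binding _ hkl).2
    linarith [alloc_table_le k l, alloc_table_le l k]
  · have slack : (lamTab * 10 ^ 18 * (1000 + k) : ℝ) ≤
        utilityTab k l + utilityTab l k + lamTab * 10 ^ 18 * l := by
      exact_mod_cast (utilityTab_binding _ hkl).1
    rw [abs_gridPt_sub_of_mem _ hkl, gridPt_eq_div, gridPt_eq_div]
    linarith [le_gridUtility_table k l, le_gridUtility_table l k]
  · simp
  · simp
  · have : lamTab ≤ lamUpper := by decide
    gcongr

/-- A direction `(Q, R, lam)` in which the objective does not decrease and the binding constraints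
lose at most `ε`. -/
structure ImprovingDirection (ε : ℝ) (Q R : Fin (1000 + 1) → ℝ) (lam : ℝ) : Prop where
  feasible : ∀ k l, (k, l) ∈ bindingFeasible → approxAlloc Q R k l + approxAlloc Q R l k ≤ ε
  competitive : ∀ k l, (k, l) ∈ bindingWelfare →
    (1 + (gridPt k - gridPt l)) * lam ≤ approxUtility Q R k l + approxUtility Q R l k + ε
  nonneg : ∀ k ∈ [311, 312, 500, 1000], 0 ≤ R k
  lam_nonneg : 0 ≤ lam

variable {Q' R' : Fin (1000 + 1) → ℝ} {ε : ℝ}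

lemma approxAlloc_sub (k l : Fin (1000 + 1)) : approxAlloc (Q - Q') (R - R') k l =
    approxAlloc Q R k l - approxAlloc Q' R' k l := by
  simp only [approxAlloc, Pi.sub_apply]
  ring

lemma approxUtility_sub (k l : Fin (1000 + 1)) : approxUtility (Q - Q') (R - R') k l =
    approxUtility Q R k l - approxUtility Q' R' k l := by
  simp only [approxUtility, approxAlloc_sub]
  ring

lemma ImprovingDirection.of_lpFeasible (h : LPFeasible 1000 (2.92 / 2000) Q R lam)
    (hlam : lamTab / 10 ^ 18 ≤ lam) :
    ImprovingDirection (2 / 10 ^ 14) (Q - tableQ) (R - tableR) (lam - lamTab / 10 ^ 18) where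
  feasible k l hkl := by
    have tight : (99854 * 10 ^ 31 : ℝ) ≤ allocTab k l + allocTab l k + 11 * 10 ^ 21 := by
      exact_mod_cast (allocTab_binding _ hkl).1
    rw [← approxAlloc_table, ← approxAlloc_table] at tight
    rw [approxAlloc_sub, approxAlloc_sub]
    have hQ k := (h.nonneg k).1
    linarith [h.feasible k l, approxAlloc_le_alloc (R := R) hQ k l,
      approxAlloc_le_alloc (R := R) hQ l k]
  competitive k l hkl := by
    have tight : (utilityTab k l + utilityTab l k + lamTab * 10 ^ 18 * l : ℝ) ≤
        lamTab * 10 ^ 18 * (1000 + k) + 10 ^ 25 := by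
      exact_mod_cast (utilityTab_binding _ hkl).2
    have hQ2 k : Q k ≤ 2 := by linarith [(h.variables_le (by norm_num)).1 k]
    have hQ k := (h.nonneg k).1
    have competitive := h.competitive k l
    rw [abs_gridPt_sub_of_mem _ hkl] at competitive
    rw [← approxUtility_table, ← approxUtility_table,
      show ((k : ℕ) : ℝ) = 1000 * gridPt k by rw [gridPt_eq_div]; ring,
      show ((l : ℕ) : ℝ) = 1000 * gridPt l by rw [gridPt_eq_div]; ring] at tight
    rw [approxUtility_sub, approxUtility_sub]
    linarith [gridUtility_le_approxUtility_add (R := R) hQ hQ2 k l,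
      gridUtility_le_approxUtility_add (R := R) hQ hQ2 l k]
  nonneg k hk := by
    have zero : ∀ k ∈ ([311, 312, 500, 1000] : List (Fin (1000 + 1))), rTab k = 0 := by
      decide +kernel
    simpa [tableR, zero k hk] using (h.nonneg k).2
  lam_nonneg := sub_nonneg.2 hlam

lemma highTab_values : highTab 632 = 102281295724665614 ∧ highTab 688 = 131180739511151822 ∧
    highTab 689 = 131633172591466731 ∧ highTab 807 = 171715569847756904 ∧
    highTab 1000 = 193147180559945063 := by
  decide +kernel

lemma approxAlloc_of_le {k : Fin (1000 + 1)} (hk : (k : ℕ) ≤ 500) (l : Fin (1000 + 1)) :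
    approxAlloc Q R k l = (k : ℕ) / 1000 * Q l + R l := by
  have highTab_eq_zero : highTab k = 0 := by
    unfold highTab
    simp only [Nat.sub_eq_zero_of_le hk, logTab, zero_mul, Nat.sub_self]
  rw [approxAlloc, highTab_eq_zero, lowTab, min_eq_left hk]
  push_cast
  ring

lemma approxAlloc_of_ge {k : Fin (1000 + 1)} (hk : 500 ≤ (k : ℕ)) (l : Fin (1000 + 1)) :
    approxAlloc Q R k l = Q l / 2 + R l + highTab k / 10 ^ 18 * Q l.rev := by
  rw [approxAlloc, lowTab, min_eq_right hk]
  push_cast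
  ring

lemma approxAlloc_last (k : Fin (1000 + 1)) :
    approxAlloc Q R 1000 k = Q k / 2 + R k + 0.193147180559945063 * Q k.rev := by
  rw [approxAlloc_of_ge (by norm_num), show ((1000 : Fin (1000 + 1)) : ℕ) = 1000 from rfl,
    highTab_values.2.2.2.2]
  ring

/-- How much better than required by an improving direction the feasibility constraint `(k, l)`
is. -/
noncomputable def feasibleSlack (ε : ℝ) (Q R : Fin (1000 + 1) → ℝ) (k l : Fin (1000 + 1)) : ℝ :=
  ε - (approxAlloc Q R k l + approxAlloc Q R l k)

/-- How much better than required by an improving direction the welfare constraint `(k, l)` is. -/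
noncomputable def welfareSlack (ε : ℝ) (Q R : Fin (1000 + 1) → ℝ) (lam : ℝ)
    (k l : Fin (1000 + 1)) : ℝ :=
  approxUtility Q R k l + approxUtility Q R l k + ε - (1 + (gridPt k - gridPt l)) * lam

lemma feasibleSlack_values :
    feasibleSlack ε Q R 0 0 =
      ε - (2 * R 0) ∧
    feasibleSlack ε Q R 500 311 =
      ε - (Q 311 / 2 + R 311 + (0.311 * Q 500 + R 500)) ∧
    feasibleSlack ε Q R 500 312 =
      ε - (Q 312 / 2 + R 312 + (0.312 * Q 500 + R 500)) ∧
    feasibleSlack ε Q R 689 689 =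
      ε - (2 * (Q 689 / 2 + R 689 + 0.131633172591466731 * Q 311)) ∧
    feasibleSlack ε Q R 807 0 =
      ε - (Q 0 / 2 + R 0 + 0.171715569847756904 * Q 1000 + R 807) ∧
    feasibleSlack ε Q R 807 688 =
      ε - (Q 688 / 2 + R 688 + 0.171715569847756904 * Q 312 +
        (Q 807 / 2 + R 807 + 0.131180739511151822 * Q 193)) ∧
    feasibleSlack ε Q R 1000 0 =
      ε - (Q 0 / 2 + R 0 + 0.193147180559945063 * Q 1000 + R 1000) ∧
    feasibleSlack ε Q R 1000 193 =
      ε - (Q 193 / 2 + R 193 + 0.193147180559945063 * Q 807 + (0.193 * Q 1000 + R 1000)) ∧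
    feasibleSlack ε Q R 1000 632 =
      ε - (Q 632 / 2 + R 632 + 0.193147180559945063 * Q 368 +
        (Q 1000 / 2 + R 1000 + 0.102281295724665614 * Q 0)) := by
  obtain ⟨g632, g688, g689, g807, g1000⟩ := highTab_values
  simp only [feasibleSlack, Fin.isValue, Nat.reduceAdd, Fin.coe_ofNat_eq_mod, Nat.zero_mod,
    zero_le, approxAlloc_of_le, CharP.cast_eq_zero, zero_div, zero_mul, zero_add, Nat.reduceMod,
    Std.le_refl, Nat.cast_ofNat, Nat.reduceLeDiff, approxAlloc_of_ge, g689, Fin.reduceRev, g807,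
    Fin.rev_zero, Fin.reduceLast, g688, Nat.mod_succ, g1000, g632]
  refine ⟨?_, ?_, ?_, ?_, ?_, ?_, ?_, ?_, ?_⟩ <;> ring

lemma welfareSlack_values :
    welfareSlack ε Q R lam 193 0 =
      0.193 * (0.193 * Q 0 + R 0) +
        0.807 * (Q 1000 / 2 + R 1000 + 0.171715569847756904 * Q 0) +
        (Q 807 / 2 + R 807 + 0.193147180559945063 * Q 193) + ε - 1.193 * lam ∧
    welfareSlack ε Q R lam 311 0 =
      0.311 * (0.311 * Q 0 + R 0) +
        0.689 * (Q 1000 / 2 + R 1000 + 0.131633172591466731 * Q 0) +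
        (Q 689 / 2 + R 689 + 0.193147180559945063 * Q 311) + ε - 1.311 * lam ∧
    welfareSlack ε Q R lam 312 0 =
      0.312 * (0.312 * Q 0 + R 0) +
        0.688 * (Q 1000 / 2 + R 1000 + 0.131180739511151822 * Q 0) +
        (Q 688 / 2 + R 688 + 0.193147180559945063 * Q 312) + ε - 1.312 * lam ∧
    welfareSlack ε Q R lam 368 0 =
      0.368 * (0.368 * Q 0 + R 0) +
        0.632 * (Q 1000 / 2 + R 1000 + 0.102281295724665614 * Q 0) +
        (Q 632 / 2 + R 632 + 0.193147180559945063 * Q 368) + ε - 1.368 * lam ∧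
    welfareSlack ε Q R lam 500 193 =
      (Q 193 / 2 + R 193) / 2 + (Q 807 / 2 + R 807) / 2 + 0.193 * (0.193 * Q 500 + R 500) +
        0.807 * (Q 500 / 2 + R 500 + 0.171715569847756904 * Q 500) + ε - 1.307 * lam := by
  obtain ⟨g632, g688, g689, g807, g1000⟩ := highTab_values
  simp only [welfareSlack, approxUtility, Fin.isValue, gridPt_eq_div, Nat.reduceAdd,
    Fin.coe_ofNat_eq_mod, Nat.reduceMod, Nat.cast_ofNat, Nat.reduceLeDiff, approxAlloc_of_le,
    Fin.reduceRev, Fin.rev_zero, Fin.reduceLast, approxAlloc_of_ge, g807, Nat.zero_mod,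
    CharP.cast_eq_zero, zero_div, zero_le, zero_mul, zero_add, sub_zero, Nat.mod_succ, g1000,
    one_mul, g689, g688, g632, Std.le_refl]
  refine ⟨?_, ?_, ?_, ?_, ?_⟩ <;> ring

/-- Dual weights of the binding feasibility constraints, in units of `10⁻⁴` and rounded down. -/
def feasibleWeights : List ((Fin (1000 + 1) × Fin (1000 + 1)) × ℕ) :=
  [((0, 0), 232), ((500, 311), 364), ((500, 312), 8), ((689, 689), 1481), ((807, 0), 38),
   ((807, 688), 191), ((1000, 0), 1968), ((1000, 193), 100), ((1000, 632), 3982)]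

/-- Dual weights of the binding welfare constraints, in units of `10⁻⁴` and rounded down. -/
def welfareWeights : List ((Fin (1000 + 1) × Fin (1000 + 1)) × ℕ) :=
  [((193, 0), 129), ((311, 0), 2962), ((312, 0), 191), ((368, 0), 3982), ((500, 193), 200)]

/-- Dual weights of the binding constraints `0 ≤ R k`, in units of `10⁻⁴` and rounded down. -/
def nonnegWeights : List (Fin (1000 + 1) × ℕ) := [(311, 364), (312, 8), (500, 172), (1000, 1256)]

/-- The total slack of the binding constraints, weighted by the rounded dual weights. -/
noncomputable def weightedSlack (ε : ℝ) (Q R : Fin (1000 + 1) → ℝ) (lam : ℝ) : ℝ :=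
  (feasibleWeights.map fun c => c.2 * feasibleSlack ε Q R c.1.1 c.1.2).sum +
    (welfareWeights.map fun c => c.2 * welfareSlack ε Q R lam c.1.1 c.1.2).sum +
    (nonnegWeights.map fun c => c.2 * R c.1).sum

/-- The grid points at which both coefficients of an optimal solution are determined. -/
def coreIdx : List (Fin (1000 + 1)) := [0, 193, 311, 312, 500, 807, 1000]

/-- The grid points at which only the allocation `alloc Q R 1` of an optimal solution is
determined. -/
def partialIdx : List (Fin (1000 + 1)) := [632, 688, 689]

lemma sum_map_nonneg {α : Type*} {f : α → ℝ} {s : List α} (h : ∀ c ∈ s, 0 ≤ f c) :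
    0 ≤ (s.map f).sum :=
  List.sum_nonneg (by simpa using h)

lemma le_sum_map {α : Type*} {f : α → ℝ} {s : List α} (h : ∀ c ∈ s, 0 ≤ f c) :
    ∀ c ∈ s, f c ≤ (s.map f).sum := fun c hc =>
  List.single_le_sum (by simpa using h) _ (List.mem_map_of_mem hc)

namespace ImprovingDirection

lemma feasibleSlack_nonneg (h : ImprovingDirection ε Q R lam) :
    ∀ c ∈ feasibleWeights, 0 ≤ feasibleSlack ε Q R c.1.1 c.1.2 := by
  have binding : ∀ c ∈ feasibleWeights, c.1 ∈ bindingFeasible := by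
    simp [feasibleWeights, bindingFeasible]
  exact fun c hc => sub_nonneg.2 (h.feasible _ _ (binding c hc))

lemma welfareSlack_nonneg (h : ImprovingDirection ε Q R lam) :
    ∀ c ∈ welfareWeights, 0 ≤ welfareSlack ε Q R lam c.1.1 c.1.2 := by
  have binding : ∀ c ∈ welfareWeights, c.1 ∈ bindingWelfare := by
    simp [welfareWeights, bindingWelfare]
  exact fun c hc => sub_nonneg.2 (h.competitive _ _ (binding c hc))

lemma R_nonneg (h : ImprovingDirection ε Q R lam) : ∀ c ∈ nonnegWeights, 0 ≤ R c.1 := by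
  have binding : ∀ c ∈ nonnegWeights, c.1 ∈ [311, 312, 500, 1000] := by simp [nonnegWeights]
  exact fun c hc => h.nonneg _ (binding c hc)

/-- With the exact dual weights, the sum `lam + weightedSlack / 10 ^ 4` is `ε` times the total
weight of the constraints, which is about `1.58`. -/
lemma add_weightedSlack_le (h : ImprovingDirection ε Q R lam) :
    10 ^ 4 * lam + weightedSlack ε Q R lam ≤ 2 * 10 ^ 4 * ε := by
  have feasible := h.feasibleSlack_nonneg
  have competitive := h.welfareSlack_nonneg
  have nonneg := h.R_nonneg
  have lam_nonneg := h.lam_nonneg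
  obtain ⟨f1, f2, f3, f4, f5, f6, f7, f8, f9⟩ := feasibleSlack_values (Q := Q) (R := R) (ε := ε)
  obtain ⟨w1, w2, w3, w4, w5⟩ := welfareSlack_values (Q := Q) (R := R) (ε := ε) (lam := lam)
  simp only [feasibleWeights, Fin.isValue, List.mem_cons, List.not_mem_nil, or_false,
    forall_eq_or_imp, forall_eq, f1, f2, f3, f4, f5, f6, f7, f8, f9, welfareWeights, w1, w2, w3, w4,
    w5, nonnegWeights, weightedSlack, List.map_cons, Nat.cast_ofNat, List.map_nil, List.sum_cons,
    List.sum_nil, add_zero] at feasible competitive nonneg ⊢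
  linarith

lemma weighted_le (h : ImprovingDirection ε Q R lam) :
    (∀ c ∈ feasibleWeights, c.2 * feasibleSlack ε Q R c.1.1 c.1.2 ≤ 2 * 10 ^ 4 * ε) ∧
    (∀ c ∈ welfareWeights, c.2 * welfareSlack ε Q R lam c.1.1 c.1.2 ≤ 2 * 10 ^ 4 * ε) ∧
    (∀ c ∈ nonnegWeights, c.2 * R c.1 ≤ 2 * 10 ^ 4 * ε) ∧ lam ≤ 2 * ε := by
  have feasible : ∀ c ∈ feasibleWeights, 0 ≤ c.2 * feasibleSlack ε Q R c.1.1 c.1.2 :=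
    fun c hc => mul_nonneg c.2.cast_nonneg (h.feasibleSlack_nonneg c hc)
  have competitive : ∀ c ∈ welfareWeights, 0 ≤ c.2 * welfareSlack ε Q R lam c.1.1 c.1.2 :=
    fun c hc => mul_nonneg c.2.cast_nonneg (h.welfareSlack_nonneg c hc)
  have nonneg : ∀ c ∈ nonnegWeights, 0 ≤ c.2 * R c.1 :=
    fun c hc => mul_nonneg c.2.cast_nonneg (h.R_nonneg c hc)
  have total := h.add_weightedSlack_le
  have lam_nonneg := h.lam_nonneg
  have feasible_sum := sum_map_nonneg feasible
  have competitive_sum := sum_map_nonneg competitive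
  have nonneg_sum := sum_map_nonneg nonneg
  rw [weightedSlack] at total
  exact ⟨fun c hc => by linarith [le_sum_map feasible c hc],
    fun c hc => by linarith [le_sum_map competitive c hc],
    fun c hc => by linarith [le_sum_map nonneg c hc], by linarith⟩

lemma lam_le (h : ImprovingDirection ε Q R lam) : lam ≤ 2 * ε := h.weighted_le.2.2.2

lemma ε_nonneg (h : ImprovingDirection ε Q R lam) : 0 ≤ ε := by
  linarith [h.lam_nonneg, h.lam_le]

lemma feasibleSlack_bounds (h : ImprovingDirection ε Q R lam) (k l : Fin (1000 + 1)) (w : ℕ)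
    (hc : ((k, l), w) ∈ feasibleWeights) :
    0 ≤ feasibleSlack ε Q R k l ∧ w * feasibleSlack ε Q R k l ≤ 2 * 10 ^ 4 * ε :=
  ⟨h.feasibleSlack_nonneg ((k, l), w) hc, h.weighted_le.1 ((k, l), w) hc⟩

lemma welfareSlack_bounds (h : ImprovingDirection ε Q R lam) (k l : Fin (1000 + 1)) (w : ℕ)
    (hc : ((k, l), w) ∈ welfareWeights) :
    0 ≤ welfareSlack ε Q R lam k l ∧ w * welfareSlack ε Q R lam k l ≤ 2 * 10 ^ 4 * ε :=
  ⟨h.welfareSlack_nonneg ((k, l), w) hc, h.weighted_le.2.1 ((k, l), w) hc⟩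

lemma R_bounds (h : ImprovingDirection ε Q R lam) (k : Fin (1000 + 1)) (w : ℕ)
    (hc : (k, w) ∈ nonnegWeights) : 0 ≤ R k ∧ w * R k ≤ 2 * 10 ^ 4 * ε :=
  ⟨h.R_nonneg (k, w) hc, h.weighted_le.2.2.1 (k, w) hc⟩

lemma abs_endpoint_le (h : ImprovingDirection ε Q R lam) :
    |Q 0| ≤ 250 * ε ∧ |R 0| ≤ 50 * ε ∧ |Q 1000| ≤ 250 * ε ∧ |R 1000| ≤ 20 * ε ∧
      |approxAlloc Q R 1000 632| ≤ 100 * ε := by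
  obtain ⟨R_1000_lower, R_1000_upper⟩ := h.R_bounds 1000 1256 (by simp [nonnegWeights])
  obtain ⟨feasible_0_0_lower, feasible_0_0_upper⟩ :=
    h.feasibleSlack_bounds 0 0 232 (by simp [feasibleWeights])
  obtain ⟨feasible_1000_0_lower, feasible_1000_0_upper⟩ :=
    h.feasibleSlack_bounds 1000 0 1968 (by simp [feasibleWeights])
  obtain ⟨feasible_1000_632_lower, feasible_1000_632_upper⟩ :=
    h.feasibleSlack_bounds 1000 632 3982 (by simp [feasibleWeights])
  obtain ⟨welfare_368_0_lower, welfare_368_0_upper⟩ :=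
    h.welfareSlack_bounds 368 0 3982 (by simp [welfareWeights])
  obtain ⟨feasible_0_0_eq, -, -, -, -, -, feasible_1000_0_eq, -, feasible_1000_632_eq⟩ :=
    feasibleSlack_values (Q := Q) (R := R) (ε := ε)
  obtain ⟨-, -, -, welfare_368_0_eq, -⟩ :=
    welfareSlack_values (Q := Q) (R := R) (ε := ε) (lam := lam)
  rw [approxAlloc_last, show Fin.rev (632 : Fin (1000 + 1)) = 368 by decide]
  have lam_nonneg := h.lam_nonneg
  have lam_le := h.lam_le
  simp only [abs_le, Nat.cast_ofNat] at *
  constructorm* _ ∧ _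
  all_goals linarith

lemma abs_interior_R_le (h : ImprovingDirection ε Q R lam) :
    |R 311| ≤ 60 * ε ∧ |R 312| ≤ 2500 * ε ∧ |R 500| ≤ 120 * ε ∧ |R 807| ≤ 1000 * ε := by
  obtain ⟨Q_0, R_0, Q_1000, R_1000, -⟩ := h.abs_endpoint_le
  obtain ⟨R_311_lower, R_311_upper⟩ := h.R_bounds 311 364 (by simp [nonnegWeights])
  obtain ⟨R_312_lower, R_312_upper⟩ := h.R_bounds 312 8 (by simp [nonnegWeights])
  obtain ⟨R_500_lower, R_500_upper⟩ := h.R_bounds 500 172 (by simp [nonnegWeights])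
  obtain ⟨feasible_807_0_lower, feasible_807_0_upper⟩ :=
    h.feasibleSlack_bounds 807 0 38 (by simp [feasibleWeights])
  obtain ⟨-, -, -, -, feasible_807_0_eq, -⟩ := feasibleSlack_values (Q := Q) (R := R) (ε := ε)
  simp only [abs_le, Nat.cast_ofNat] at *
  constructorm* _ ∧ _
  all_goals linarith

lemma abs_Q_311_le (h : ImprovingDirection ε Q R lam) :
    |Q 311| ≤ 3000 * ε ∧ |approxAlloc Q R 1000 689| ≤ 300 * ε := by
  obtain ⟨Q_0, R_0, Q_1000, R_1000, -⟩ := h.abs_endpoint_le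
  obtain ⟨feasible_689_689_lower, feasible_689_689_upper⟩ :=
    h.feasibleSlack_bounds 689 689 1481 (by simp [feasibleWeights])
  obtain ⟨welfare_311_0_lower, welfare_311_0_upper⟩ :=
    h.welfareSlack_bounds 311 0 2962 (by simp [welfareWeights])
  obtain ⟨-, -, -, feasible_689_689_eq, -⟩ := feasibleSlack_values (Q := Q) (R := R) (ε := ε)
  obtain ⟨-, welfare_311_0_eq, -⟩ := welfareSlack_values (Q := Q) (R := R) (ε := ε) (lam := lam)
  rw [approxAlloc_last, show Fin.rev (689 : Fin (1000 + 1)) = 311 by decide]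
  have lam_nonneg := h.lam_nonneg
  have lam_le := h.lam_le
  simp only [abs_le, Nat.cast_ofNat] at *
  constructorm* _ ∧ _
  all_goals linarith

lemma abs_Q_312_le (h : ImprovingDirection ε Q R lam) :
    |Q 500| ≤ 6000 * ε ∧ |Q 312| ≤ 14000 * ε ∧ |approxAlloc Q R 1000 688| ≤ 300 * ε := by
  obtain ⟨Q_0, R_0, Q_1000, R_1000, -⟩ := h.abs_endpoint_le
  obtain ⟨R_311, R_312, R_500, -⟩ := h.abs_interior_R_le
  obtain ⟨Q_311, -⟩ := h.abs_Q_311_le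
  obtain ⟨feasible_500_311_lower, feasible_500_311_upper⟩ :=
    h.feasibleSlack_bounds 500 311 364 (by simp [feasibleWeights])
  obtain ⟨feasible_500_312_lower, feasible_500_312_upper⟩ :=
    h.feasibleSlack_bounds 500 312 8 (by simp [feasibleWeights])
  obtain ⟨welfare_312_0_lower, welfare_312_0_upper⟩ :=
    h.welfareSlack_bounds 312 0 191 (by simp [welfareWeights])
  obtain ⟨-, feasible_500_311_eq, feasible_500_312_eq, -⟩ :=
    feasibleSlack_values (Q := Q) (R := R) (ε := ε)
  obtain ⟨-, -, welfare_312_0_eq, -⟩ := welfareSlack_values (Q := Q) (R := R) (ε := ε) (lam := lam)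
  rw [approxAlloc_last, show Fin.rev (688 : Fin (1000 + 1)) = 312 by decide]
  have lam_nonneg := h.lam_nonneg
  have lam_le := h.lam_le
  simp only [abs_le, Nat.cast_ofNat] at *
  constructorm* _ ∧ _
  all_goals linarith

lemma abs_Q_193_le (h : ImprovingDirection ε Q R lam) :
    |Q 193| ≤ 18000 * ε ∧ |Q 807| ≤ 10000 * ε ∧ |R 193| ≤ 12000 * ε := by
  obtain ⟨Q_0, R_0, Q_1000, R_1000, -⟩ := h.abs_endpoint_le
  obtain ⟨-, -, -, R_807⟩ := h.abs_interior_R_le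
  obtain ⟨-, Q_312, approxAlloc_688⟩ := h.abs_Q_312_le
  obtain ⟨feasible_807_688_lower, feasible_807_688_upper⟩ :=
    h.feasibleSlack_bounds 807 688 191 (by simp [feasibleWeights])
  obtain ⟨feasible_1000_193_lower, feasible_1000_193_upper⟩ :=
    h.feasibleSlack_bounds 1000 193 100 (by simp [feasibleWeights])
  obtain ⟨welfare_193_0_lower, welfare_193_0_upper⟩ :=
    h.welfareSlack_bounds 193 0 129 (by simp [welfareWeights])
  obtain ⟨-, -, -, -, -, feasible_807_688_eq, -, feasible_1000_193_eq, -⟩ :=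
    feasibleSlack_values (Q := Q) (R := R) (ε := ε)
  obtain ⟨welfare_193_0_eq, -⟩ := welfareSlack_values (Q := Q) (R := R) (ε := ε) (lam := lam)
  rw [approxAlloc_last, show Fin.rev (688 : Fin (1000 + 1)) = 312 by decide] at approxAlloc_688
  have lam_nonneg := h.lam_nonneg
  have lam_le := h.lam_le
  simp only [abs_le, Nat.cast_ofNat] at *
  constructorm* _ ∧ _
  all_goals linarith

lemma abs_core_le (h : ImprovingDirection ε Q R lam) :
    ∀ k ∈ coreIdx, |Q k| ≤ 2 * 10 ^ 4 * ε ∧ |R k| ≤ 2 * 10 ^ 4 * ε := by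
  have ε_nonneg := h.ε_nonneg
  obtain ⟨Q_0, R_0, Q_1000, R_1000, -⟩ := h.abs_endpoint_le
  obtain ⟨R_311, R_312, R_500, R_807⟩ := h.abs_interior_R_le
  obtain ⟨Q_311, -⟩ := h.abs_Q_311_le
  obtain ⟨Q_500, Q_312, -⟩ := h.abs_Q_312_le
  obtain ⟨Q_193, Q_807, R_193⟩ := h.abs_Q_193_le
  simp only [coreIdx, List.mem_cons, List.not_mem_nil, or_false, forall_eq_or_imp, forall_eq]
  constructorm* _ ∧ _
  all_goals linarith

lemma abs_partial_le (h : ImprovingDirection ε Q R lam) :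
    ∀ k ∈ partialIdx, |approxAlloc Q R 1000 k| ≤ 2 * 10 ^ 4 * ε := by
  have ε_nonneg := h.ε_nonneg
  obtain ⟨-, -, -, -, approxAlloc_632⟩ := h.abs_endpoint_le
  obtain ⟨-, approxAlloc_689⟩ := h.abs_Q_311_le
  obtain ⟨-, -, approxAlloc_688⟩ := h.abs_Q_312_le
  simp only [partialIdx, List.mem_cons, List.not_mem_nil, or_false, forall_eq_or_imp, forall_eq]
  constructorm* _ ∧ _
  all_goals linarith

end ImprovingDirection

/-! ### An optimal solution close to the table -/

/-- The coefficient vector that agrees with `Q` at the core grid points and with the nearly optimal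
solution elsewhere. -/
noncomputable def spliceQ (Q : Fin (1000 + 1) → ℝ) (k : Fin (1000 + 1)) : ℝ :=
  if k ∈ coreIdx then Q k else tableQ k

/-- The coefficient vector that agrees with `R` at the core grid points and with the nearly optimal
solution elsewhere, except that the allocation of the unit bid at the points of `partialIdx` is
that of `(Q, R)`. -/
noncomputable def spliceR (Q R : Fin (1000 + 1) → ℝ) (k : Fin (1000 + 1)) : ℝ :=
  if k ∈ coreIdx then R k
  else if k ∈ partialIdx then
    alloc Q R 1 k - (spliceQ Q k * lowBasis 1 + spliceQ Q k.rev * highBasis 1)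
  else tableR k

/-- The pairs `(k, l)` for which splicing preserves the allocation of the bid `k / 1000` at `l`. -/
def IsPreserved (k l : Fin (1000 + 1)) : Prop :=
  l ∈ coreIdx ∧ ((k : ℕ) ≤ 500 ∨ l.rev ∈ coreIdx) ∨
    l ∈ partialIdx ∧ (k = 1000 ∨ 500 ≤ (k : ℕ) ∧ l.rev ∈ coreIdx)

instance (k l : Fin (1000 + 1)) : Decidable (IsPreserved k l) :=
  inferInstanceAs (Decidable (_ ∨ _))

lemma notMem_coreIdx : ∀ k ∈ partialIdx, k ∉ coreIdx :=
  List.all_iff_forall_prop.1 (by decide +kernel)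

lemma spliceQ_of_mem {k : Fin (1000 + 1)} (hk : k ∈ coreIdx) : spliceQ Q k = Q k := if_pos hk

lemma spliceR_of_mem {k : Fin (1000 + 1)} (hk : k ∈ coreIdx) : spliceR Q R k = R k := if_pos hk

lemma spliceR_of_mem_partialIdx {k : Fin (1000 + 1)} (hk : k ∈ partialIdx) : spliceR Q R k =
    alloc Q R 1 k - (spliceQ Q k * lowBasis 1 + spliceQ Q k.rev * highBasis 1) := by
  rw [spliceR, if_neg (notMem_coreIdx k hk), if_pos hk]

lemma alloc_splice_one {k : Fin (1000 + 1)} (hk : k ∈ partialIdx) :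
    alloc (spliceQ Q) (spliceR Q R) 1 k = alloc Q R 1 k := by
  rw [alloc_eq (Q := spliceQ Q), spliceR_of_mem_partialIdx hk]
  ring

lemma gridPt_le_half {k : Fin (1000 + 1)} (hk : (k : ℕ) ≤ 500) : gridPt k ≤ 1 / 2 := by
  have : ((k : ℕ) : ℝ) ≤ 500 := by exact_mod_cast hk
  rw [gridPt_eq_div]
  linarith

lemma half_le_gridPt {k : Fin (1000 + 1)} (hk : 500 ≤ (k : ℕ)) : 1 / 2 ≤ gridPt k := by
  have : (500 : ℝ) ≤ (k : ℕ) := by exact_mod_cast hk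
  rw [gridPt_eq_div]
  linarith

lemma alloc_splice {k l : Fin (1000 + 1)} (h : IsPreserved k l) :
    alloc (spliceQ Q) (spliceR Q R) (gridPt k) l = alloc Q R (gridPt k) l := by
  rcases h with ⟨hl, hk | hrev⟩ | ⟨hl, rfl | ⟨hk, hrev⟩⟩
  · rw [alloc_eq, alloc_eq, spliceQ_of_mem hl, spliceR_of_mem hl,
      highBasis_of_le (gridPt_le_half hk), mul_zero, mul_zero]
  · rw [alloc_eq, alloc_eq, spliceQ_of_mem hl, spliceR_of_mem hl, spliceQ_of_mem hrev]
  · rw [show gridPt (1000 : Fin (1000 + 1)) = 1 from gridPt_last (by norm_num), alloc_splice_one hl]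
  · have unit_bid := alloc_splice_one (Q := Q) (R := R) hl
    rw [alloc_eq, alloc_eq, spliceQ_of_mem hrev, lowBasis_of_ge (by norm_num)] at unit_bid
    rw [alloc_eq, alloc_eq, spliceQ_of_mem hrev, lowBasis_of_ge (half_le_gridPt hk)]
    linarith

lemma gridUtility_splice {k l : Fin (1000 + 1)} (h : k = 0 ∨ IsPreserved k l)
    (hrev : IsPreserved k.rev l.rev) :
    gridUtility (spliceQ Q) (spliceR Q R) k l = gridUtility Q R k l := by
  rw [gridUtility, gridUtility, alloc_splice hrev]
  rcases h with rfl | h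
  · simp only [gridPt_zero, zero_mul]
  · rw [alloc_splice h]

lemma isPreserved_of_mem_bindingFeasible :
    ∀ p ∈ bindingFeasible, IsPreserved p.1 p.2 ∧ IsPreserved p.2 p.1 :=
  List.all_iff_forall_prop.1 (by decide +kernel)

lemma isPreserved_of_mem_bindingWelfare : ∀ p ∈ bindingWelfare,
    (p.1 = 0 ∨ IsPreserved p.1 p.2) ∧ IsPreserved p.1.rev p.2.rev ∧
      (p.2 = 0 ∨ IsPreserved p.2 p.1) ∧ IsPreserved p.2.rev p.1.rev :=
  List.all_iff_forall_prop.1 (by decide +kernel)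

lemma two_mul_lt_rTab : ∀ k ∈ partialIdx, 2 * 10 ^ 9 < rTab k :=
  List.all_iff_forall_prop.1 (by decide +kernel)

lemma abs_spliceQ_sub_le (h : LPFeasible 1000 (2.92 / 2000) Q R lam)
    (hlam : lamTab / 10 ^ 18 ≤ lam) (k : Fin (1000 + 1)) :
    |spliceQ Q k - tableQ k| ≤ 4 / 10 ^ 10 := by
  rw [spliceQ]
  split_ifs with hk
  · exact ((ImprovingDirection.of_lpFeasible h hlam).abs_core_le k hk).1.trans (by norm_num)
  · rw [sub_self, abs_zero]
    positivity

lemma abs_alloc_one_sub_le (h : LPFeasible 1000 (2.92 / 2000) Q R lam)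
    (hlam : lamTab / 10 ^ 18 ≤ lam) {k : Fin (1000 + 1)} (hk : k ∈ partialIdx) :
    |alloc Q R 1 k - alloc tableQ tableR 1 k| ≤ 5 / 10 ^ 10 := by
  have direction := (ImprovingDirection.of_lpFeasible h hlam).abs_partial_le k hk
  rw [approxAlloc_sub, abs_le] at direction
  have hQ2 k : Q k ≤ 2 := by linarith [(h.variables_le (by norm_num)).1 k]
  have tableQ_le_two k : tableQ k ≤ 2 := (tableQ_le k).trans (by norm_num)
  have hQ k := (h.nonneg k).1
  have lower := approxAlloc_le_alloc (R := R) hQ 1000 k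
  have upper := alloc_le_approxAlloc_add (R := R) hQ hQ2 1000 k
  have table_lower := approxAlloc_le_alloc (R := tableR) tableQ_nonneg 1000 k
  have table_upper := alloc_le_approxAlloc_add (R := tableR) tableQ_nonneg tableQ_le_two 1000 k
  rw [show gridPt (1000 : Fin (1000 + 1)) = 1 from gridPt_last (by norm_num)] at *
  rw [abs_le]
  constructor <;> linarith

lemma nearTable_splice (h : LPFeasible 1000 (2.92 / 2000) Q R lam)
    (hlam : lamTab / 10 ^ 18 ≤ lam) : NearTable (spliceQ Q) (spliceR Q R) where
  abs_Q_sub_le k := (abs_spliceQ_sub_le h hlam k).trans (by norm_num)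
  abs_R_sub_le k := by
    rw [spliceR]
    split_ifs with hcore hpartial
    · exact ((ImprovingDirection.of_lpFeasible h hlam).abs_core_le k hcore).2.trans (by norm_num)
    · have unit_bid := abs_le.1 (abs_alloc_one_sub_le h hlam hpartial)
      rw [alloc_eq tableQ, lowBasis_of_ge (by norm_num)] at unit_bid
      have Q_near := abs_le.1 (abs_spliceQ_sub_le h hlam k)
      have Q_rev_near := abs_le.1 (abs_spliceQ_sub_le h hlam k.rev)
      have high_nonneg : 0 ≤ highBasis 1 := highBasis_nonneg zero_le_one le_rfl
      have high_le : highBasis 1 ≤ 1 / 2 := by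
        linarith [lowBasis_add_highBasis_le zero_le_one, lowBasis_of_ge (t := 1) (by norm_num)]
      rw [lowBasis_of_ge (by norm_num), abs_le]
      constructor <;> nlinarith
    · rw [sub_self, abs_zero]
      positivity

lemma splice_nonneg (h : LPFeasible 1000 (2.92 / 2000) Q R lam) (hlam : lamTab / 10 ^ 18 ≤ lam)
    (k : Fin (1000 + 1)) : 0 ≤ spliceQ Q k ∧ 0 ≤ spliceR Q R k := by
  constructor
  · rw [spliceQ]
    split_ifs
    exacts [(h.nonneg k).1, tableQ_nonneg k]
  · by_cases hpartial : k ∈ partialIdx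
    · have table_pos : (2 * 10 ^ 9 : ℝ) < rTab k := by exact_mod_cast two_mul_lt_rTab k hpartial
      have near := (abs_le.1 ((nearTable_splice h hlam).abs_R_sub_le k)).1
      rw [tableR] at near
      linarith
    · rw [spliceR, if_neg hpartial]
      split_ifs
      exacts [(h.nonneg k).2, tableR_nonneg k]

theorem lpFeasible_splice (h : LPFeasible 1000 (2.92 / 2000) Q R lam)
    (hlam : lamTab / 10 ^ 18 ≤ lam) :
    LPFeasible 1000 (2.92 / 2000) (spliceQ Q) (spliceR Q R) lam := by
  refine BindingConstraints.lpFeasible ⟨fun k l hkl => ?_, fun k l hkl => ?_, splice_nonneg h hlam⟩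
    (nearTable_splice h hlam) ?_
  · obtain ⟨hkl, hlk⟩ := isPreserved_of_mem_bindingFeasible _ hkl
    rw [alloc_splice hkl, alloc_splice hlk]
    exact h.feasible k l
  · obtain ⟨hkl, hkl_rev, hlk, hlk_rev⟩ := isPreserved_of_mem_bindingWelfare _ hkl
    rw [gridUtility_splice hkl hkl_rev, gridUtility_splice hlk hlk_rev]
    exact h.competitive k l
  · have lam_le := (ImprovingDirection.of_lpFeasible h hlam).lam_le
    norm_num [lamTab, lamUpper] at lam_le ⊢
    linarith

lemma LPOptimal.lamTab_le (h : LPOptimal 1000 (2.92 / 2000) Q R lam) : lamTab / 10 ^ 18 ≤ lam :=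
  h.2 _ _ _ lpFeasible_table

lemma LPOptimal.lt_lam (h : LPOptimal 1000 (2.92 / 2000) Q R lam) : 0.835524 < lam :=
  lt_of_lt_of_le (by norm_num [lamTab]) h.lamTab_le

theorem LPOptimal.splice (h : LPOptimal 1000 (2.92 / 2000) Q R lam) :
    LPOptimal 1000 (2.92 / 2000) (spliceQ Q) (spliceR Q R) lam :=
  ⟨lpFeasible_splice h.1 h.lamTab_le, h.2⟩

lemma LPOptimal.spliceQ_lt (h : LPOptimal 1000 (2.92 / 2000) Q R lam) (k : Fin (1000 + 1)) :
    spliceQ Q k < 1.46 := by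
  linarith [(abs_le.1 (abs_spliceQ_sub_le h.1 h.lamTab_le k)).2, tableQ_le k]

end PartialMechanism

open PartialMechanism in
theorem mainTheorem2 :
    (∃ (Q R : Fin (1000 + 1) → ℝ) (lam : ℝ),
      LPOptimal 1000 (2.92 / 2000) Q R lam ∧ 0.835524 < lam ∧ ∀ k, Q k < 1.46) ∧
    (∃ ρ : ℝ → Fin (1000 + 1), IsRounding 1000 ρ) ∧
    (∀ (Q R : Fin (1000 + 1) → ℝ) (lam : ℝ),
      LPOptimal 1000 (2.92 / 2000) Q R lam → (∀ k, Q k < 1.46) →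
      ∀ ρ : ℝ → Fin (1000 + 1), IsRounding 1000 ρ →
        IsSymmetric (roundedMechanism Q R ρ) ∧
        IsFeasible (roundedMechanism Q R ρ) ∧
        IsStrategyproof (roundedMechanism Q R ρ) ∧
        IsCompetitive 0.833689 (roundedMechanism Q R ρ)) ∧
    (5 / 6 + 1 / 10 ^ 9 : ℝ) < 0.833689 := by
  refine ⟨?_, exists_isRounding (n := 500) (by norm_num),
    fun Q R lam hopt hQ ρ hρ => ⟨isSymmetric_ofFun _, ?_, ?_, ?_⟩, by norm_num⟩
  · obtain ⟨Q, R, lam, hopt⟩ := exists_lpOptimal (by norm_num) lpFeasible_table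
    exact ⟨spliceQ Q, spliceR Q R, lam, hopt.splice, hopt.lt_lam, hopt.spliceQ_lt⟩
  · exact isFeasible_roundedMechanism (by norm_num) hopt.1 (fun k => (hQ k).le) (by norm_num) hρ
  · exact isStrategyproof_roundedMechanism (fun k => (hopt.1.nonneg k).1) hρ
  · have hlam := hopt.lt_lam
    exact isCompetitive_roundedMechanism (by norm_num) hopt.1 hρ (by norm_num) (by linarith)
      (by norm_num; linarith)
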